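/- In the adjacency-matrix quantum query model, an algorithm accesses an undirected simple graph $G$ on the vertex set $[n]$ through the unitary oracle $O_G|(v,u)\rangle|q\rangle=|(v,u)\rangle|q\oplus E_G(v,u)\rangle$, where $q\in\{0,1\}$ and $E_G(v,u)=1$ if and only if $vu$ is an edge of $G$. A quantum query algorithm applies a sequence $U_0,O_G,U_1,O_G,\dots,O_G,U_T$ to a fixed initial state, where $U_0,\dots,U_T$ are arbitrary unitary operators that do not depend on $G$, $O_G$ acts on part of a possibly larger finite system, and the final state is measured in the computational basis to determine the output; $T$ is its number of queries. Theorem. There is an absolute constant $C$ such that for all integers $n\ge 1$ and $k\ge 1$ there is a quantum query algorithm with at most $C\left(\sqrt{k}\,n+k^{3/2}\sqrt{n}\right)$ queries which, for every graph $G$ on $n$ vertices, with probability at least $2/3$ outputs a vertex cover of $G$ of size at most $k$ if one exists, and reports that none exists otherwise. That is, the bounded-error quantum query complexity of finding a vertex cover of size at most $k$ or determining that there is none is $O(\sqrt{k}\,n+k^{3/2}\sqrt{n})$. -/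

import Mathlib

namespace QuantumQuery

/-- Labels of the computational basis of the Hilbert space of an algorithm on `n`-vertex graphs:
a query register holding a pair of vertices `(v, u)`, an answer bit `q`, and a workspace
with basis labelled by `W`. -/
abbrev Basis (n : ℕ) (W : Type) : Type := (Fin n × Fin n) × Bool × W

open Classical in
/-- The entry of the adjacency matrix of `G` at a pair of vertices, as a bit. -/
noncomputable def adjBit {n : ℕ} (G : SimpleGraph (Fin n)) (p : Fin n × Fin n) : Bool :=
  decide (G.Adj p.1 p.2)

/-- The action of the adjacency matrix oracle on basis states,
`|(v, u)⟩ |q⟩ |w⟩ ↦ |(v, u)⟩ |q ⊕ E(v, u)⟩ |w⟩`. -/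
noncomputable def oracleMap {n : ℕ} (G : SimpleGraph (Fin n)) {W : Type} (b : Basis n W) :
    Basis n W :=
  (b.1, xor b.2.1 (adjBit G b.1), b.2.2)

open Classical in
/-- The query operator of `G`, as a matrix in the computational basis: the column of `b` is the
basis vector of `oracleMap G b`. -/
noncomputable def oracle {n : ℕ} (G : SimpleGraph (Fin n)) (W : Type) :
    Matrix (Basis n W) (Basis n W) ℂ :=
  Matrix.of fun a b => if a = oracleMap G b then 1 else 0

/-- A quantum query algorithm on `n`-vertex graphs with outputs in `α`. It has a finite
workspace, starts in a computational basis state, applies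
`U 0, O, U 1, O, …, O, U T` with `T = queries`, measures in the computational basis, and
outputs a function of the measured label. The unitaries do not depend on the input graph
(those with index larger than `queries` are never used). -/
structure Algorithm (n : ℕ) (α : Type) where
  /-- the labels of the basis of the workspace -/
  W : Type
  [fintypeW : Fintype W]
  [decEqW : DecidableEq W]
  /-- the number of oracle calls -/
  queries : ℕ
  /-- the unitaries that are applied between the oracle calls -/
  U : ℕ → Matrix.unitaryGroup (Basis n W) ℂ
  /-- the initial basis state -/
  init : Basis n W
  /-- the output for each outcome of the final measurement -/
  out : Basis n W → α

attribute [instance] Algorithm.fintypeW Algorithm.decEqW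

namespace Algorithm

variable {n : ℕ} {α : Type}

/-- The vector of amplitudes after `t` oracle calls and the unitary `U t`, on input `G`. -/
noncomputable def state (A : Algorithm n α) (G : SimpleGraph (Fin n)) : ℕ → (Basis n A.W → ℂ)
  | 0 => (A.U 0 : Matrix (Basis n A.W) (Basis n A.W) ℂ).mulVec (Pi.single A.init 1)
  | t + 1 => (A.U (t + 1) : Matrix (Basis n A.W) (Basis n A.W) ℂ).mulVec
      ((oracle G A.W).mulVec (A.state G t))

open Classical in
/-- The probability that the output on input `G` satisfies `P`. -/
noncomputable def prob (A : Algorithm n α) (G : SimpleGraph (Fin n)) (P : α → Prop) : ℝ :=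
  ∑ b : Basis n A.W with P (A.out b), ‖A.state G A.queries b‖ ^ 2

/-- On every input graph, the algorithm gives an output that is correct for that graph
with probability at least `2/3`. -/
def SolvesWithBoundedError (A : Algorithm n α) (Correct : SimpleGraph (Fin n) → α → Prop) :
    Prop :=
  ∀ G : SimpleGraph (Fin n), 2 / 3 ≤ A.prob G (Correct G)

end Algorithm

/-- Correct outputs for finding a vertex cover of size at most `k`: such a vertex cover, or
`none` (the claim that there is none) if there is no such vertex cover. -/
def VertexCoverCorrect {n : ℕ} (k : ℕ) (G : SimpleGraph (Fin n)) :
    Option (Finset (Fin n)) → Prop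
  | some S => G.IsVertexCover (S : Set (Fin n)) ∧ S.card ≤ k
  | none => ¬ ∃ S : Finset (Fin n), G.IsVertexCover (S : Set (Fin n)) ∧ S.card ≤ k

end QuantumQuery

/-! ### Query algorithms: norm preservation and expected values of outputs -/

namespace QuantumQuery

open Matrix

variable {n : ℕ}

/-! The algorithm is a kernelization fed by Grover search. Every vertex cover contains a vertex of
each edge of a matching, so a matching with `k + 1` edges excludes covers of size `k`. Otherwise a
maximal matching has at most `2k` endpoints, and they meet every edge. At each endpoint, edges are
collected until all of them or `k + 1` of them are known. Any set of at most `k` vertices covering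
the collected edges then covers `G` (`isVertexCover_of_covers`), and looking for such a set takes no
queries.

Both phases are greedy searches: at most `K` edges are found one after the other in a shrinking set
of at most `N` pairs. With `r` edges still available, Grover search needs about `√(N/r)` queries for
the next one, and summing over `r ≤ K` gives `√(NK)`. The pairs `(N, K) = (n², k + 1)` and `(2kn,
2k(k + 1))` give the two terms of the bound.

To avoid a logarithmic factor, single searches are not amplified. Each block of attempts lowers the
potential `r` with probability at least `1/4`, and a drift argument (`mul_expect_run_le`) bounds the
failure of many repetitions. The stages treat `16^i ≤ r < 16^(i+1)` with an effort factor `a` that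
doubles as `i` decreases, so that costs and failure probabilities are both geometric sums
(`cost_stages_le`, `expect_run_stages_le`).

The algorithm is assembled as a randomized program with a query count fixed in advance.
`expect_bind` justifies this: intermediate measurements are deferred by moving each outcome into its
own orthogonal block. -/

theorem oracleMap_involutive (G : SimpleGraph (Fin n)) (W : Type) :
    Function.Involutive (oracleMap G : Basis n W → Basis n W) := by
  rintro ⟨p, q, w⟩
  simp [oracleMap]

theorem oracle_mulVec (G : SimpleGraph (Fin n)) {W : Type} [Fintype W]
    (ψ : Basis n W → ℂ) (b : Basis n W) :
    (oracle G W *ᵥ ψ) b = ψ (oracleMap G b) := by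
  classical
  simp only [oracle, mulVec, dotProduct, of_apply, ite_mul, one_mul, zero_mul]
  rw [Finset.sum_eq_single (oracleMap G b)]
  · simp [oracleMap_involutive G W b]
  · intro c _ hc
    rw [if_neg]
    rintro rfl
    exact hc (oracleMap_involutive G W c).symm
  · simp

theorem sum_norm_sq_unitary_mulVec {ι : Type*} [Fintype ι] [DecidableEq ι]
    (U : unitaryGroup ι ℂ) (ψ : ι → ℂ) :
    ∑ b, ‖((U : Matrix ι ι ℂ) *ᵥ ψ) b‖ ^ 2 = ∑ b, ‖ψ b‖ ^ 2 := by
  have key (φ : ι → ℂ) : ((∑ b, ‖φ b‖ ^ 2 : ℝ) : ℂ) = star φ ⬝ᵥ φ := by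
    simp [dotProduct, Complex.conj_mul']
  have hU : star (U : Matrix ι ι ℂ) * (U : Matrix ι ι ℂ) = 1 := U.2.1
  apply Complex.ofReal_injective
  rw [key, key, star_mulVec, ← dotProduct_mulVec, mulVec_mulVec, ← star_eq_conjTranspose, hU,
    one_mulVec]

namespace Algorithm

variable {α β : Type}

/-- The vector of amplitudes just before the unitary `U t` is applied. -/
noncomputable def preState (A : Algorithm n α) (G : SimpleGraph (Fin n)) :
    ℕ → (Basis n A.W → ℂ)
  | 0 => Pi.single A.init 1
  | t + 1 => oracle G A.W *ᵥ A.state G t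

theorem state_eq_mulVec_preState (A : Algorithm n α) (G : SimpleGraph (Fin n)) (t : ℕ) :
    A.state G t = (A.U t : Matrix (Basis n A.W) (Basis n A.W) ℂ) *ᵥ A.preState G t := by
  cases t <;> rfl

theorem sum_norm_sq_state (A : Algorithm n α) (G : SimpleGraph (Fin n)) (t : ℕ) :
    ∑ b, ‖A.state G t b‖ ^ 2 = 1 := by
  induction t with
  | zero =>
    rw [state, sum_norm_sq_unitary_mulVec, Finset.sum_eq_single A.init]
    · simp
    · intro b _ hb
      simp [hb]
    · simp
  | succ t ih =>
    rw [state, sum_norm_sq_unitary_mulVec, ← ih]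
    simp only [oracle_mulVec]
    exact (oracleMap_involutive G A.W).bijective.sum_comp fun b => ‖A.state G t b‖ ^ 2

/-- The expected value of `f` at the output on input `G`. -/
noncomputable def expect (A : Algorithm n α) (G : SimpleGraph (Fin n)) (f : α → ℝ) : ℝ :=
  ∑ b : Basis n A.W, ‖A.state G A.queries b‖ ^ 2 * f (A.out b)

open Classical in
theorem prob_eq_expect (A : Algorithm n α) (G : SimpleGraph (Fin n)) (P : α → Prop) :
    A.prob G P = A.expect G fun a => if P a then 1 else 0 := by
  simp [prob, expect, Finset.sum_filter]

theorem expect_mono (A : Algorithm n α) (G : SimpleGraph (Fin n)) {f g : α → ℝ}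
    (h : ∀ a, f a ≤ g a) : A.expect G f ≤ A.expect G g :=
  Finset.sum_le_sum fun _ _ => mul_le_mul_of_nonneg_left (h _) (sq_nonneg _)

theorem expect_const (A : Algorithm n α) (G : SimpleGraph (Fin n)) (c : ℝ) :
    A.expect G (fun _ => c) = c := by
  rw [expect, ← Finset.sum_mul, sum_norm_sq_state, one_mul]

theorem expect_add (A : Algorithm n α) (G : SimpleGraph (Fin n)) (f g : α → ℝ) :
    A.expect G (fun a => f a + g a) = A.expect G f + A.expect G g := by
  simp [expect, mul_add, Finset.sum_add_distrib]

theorem expect_const_mul (A : Algorithm n α) (G : SimpleGraph (Fin n)) (c : ℝ) (f : α → ℝ) :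
    A.expect G (fun a => c * f a) = c * A.expect G f := by
  simp [expect, Finset.mul_sum, mul_left_comm]

/-- Apply a function to the output. -/
def map (f : α → β) (A : Algorithm n α) : Algorithm n β where
  W := A.W
  queries := A.queries
  U := A.U
  init := A.init
  out b := f (A.out b)

theorem state_map (f : α → β) (A : Algorithm n α) (G : SimpleGraph (Fin n)) (t : ℕ) :
    (A.map f).state G t = A.state G t := by
  induction t with
  | zero => rfl
  | succ t ih => simp only [state, ih]; rfl

theorem expect_map (f : α → β) (A : Algorithm n α) (G : SimpleGraph (Fin n)) (g : β → ℝ) :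
    (A.map f).expect G g = A.expect G fun a => g (f a) := by
  simp only [expect, state_map]
  rfl

/-- Keep querying the same entry of the adjacency matrix, and output a function of the final
answer bit. -/
def query (T : ℕ) (x : Fin n × Fin n) (f : Bool → α) : Algorithm n α where
  W := Unit
  queries := T
  U := 1
  init := (x, false, ())
  out b := f b.2.1

theorem state_query_one (x : Fin n × Fin n) (f : Bool → α) (G : SimpleGraph (Fin n)) :
    (query 1 x f).state G 1 = Pi.single (x, adjBit G x, ()) 1 := by
  have key (b : Basis n Unit) : ((1 : Matrix (Basis n Unit) (Basis n Unit) ℂ) *ᵥ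
      (oracle G Unit *ᵥ ((1 : Matrix (Basis n Unit) (Basis n Unit) ℂ) *ᵥ
        Pi.single (x, false, ()) 1))) b =
      (Pi.single (x, adjBit G x, ()) 1 : Basis n Unit → ℂ) b := by
    rw [one_mulVec, one_mulVec, oracle_mulVec]
    have : (x, adjBit G x, ()) = oracleMap G (x, false, ()) := by simp [oracleMap]
    rw [this]
    simp only [Pi.single_apply, (oracleMap_involutive G Unit).eq_iff]
  exact funext key

theorem expect_query_one (x : Fin n × Fin n) (f : Bool → α) (G : SimpleGraph (Fin n))
    (g : α → ℝ) : (query 1 x f).expect G g = g (f (adjBit G x)) := by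
  have h : ∀ b, (query 1 x f).state G (query 1 x f).queries b =
    (Pi.single (x, adjBit G x, ()) 1 : Basis n Unit → ℂ) b :=
    fun b => congrFun (state_query_one x f G) b
  rw [expect, Finset.sum_congr rfl fun _ _ => by rw [h]]
  refine (Finset.sum_eq_single ((x, adjBit G x, ()) : Basis n Unit) ?_ ?_).trans ?_
  · intro b _ hb
    rw [Pi.single_eq_of_ne hb]
    simp
  · intro h
    exact absurd (Finset.mem_univ _) h
  · rw [Pi.single_eq_same]
    simp [query]

end Algorithm

/-! ### Block diagonal evolution on a disjoint union of workspaces -/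

section Blocks

variable {W₁ ι : Type} {W₂ : ι → Type}

/-- The basis of a system whose workspace is a disjoint union is a disjoint union of bases. -/
def basisSumEquiv :
    Basis n (W₁ ⊕ Σ i, W₂ i) ≃ Basis n W₁ ⊕ Σ i, Basis n (W₂ i) where
  toFun b := match b with
    | (p, q, .inl w) => .inl (p, q, w)
    | (p, q, .inr ⟨i, w⟩) => .inr ⟨i, p, q, w⟩
  invFun b := match b with
    | .inl (p, q, w) => (p, q, .inl w)
    | .inr ⟨i, p, q, w⟩ => (p, q, .inr ⟨i, w⟩)
  left_inv := by rintro ⟨p, q, w | ⟨i, w⟩⟩ <;> rfl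
  right_inv := by rintro (⟨p, q, w⟩ | ⟨i, p, q, w⟩) <;> rfl

/-- A vector of the first block, as a vector of the whole system. -/
def embedFst (φ : Basis n W₁ → ℂ) : Basis n (W₁ ⊕ Σ i, W₂ i) → ℂ
  | (p, q, .inl w) => φ (p, q, w)
  | (_, _, .inr _) => 0

/-- The combination with amplitudes `φ i` of vectors `χ i` of the blocks with index `i`. -/
def embedSnd (φ : ι → ℂ) (χ : ∀ i, Basis n (W₂ i) → ℂ) : Basis n (W₁ ⊕ Σ i, W₂ i) → ℂ
  | (_, _, .inl _) => 0
  | (p, q, .inr ⟨i, w⟩) => φ i * χ i (p, q, w)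

theorem oracle_mulVec_embedFst [Fintype W₁] [Fintype ι] [∀ i, Fintype (W₂ i)]
    (G : SimpleGraph (Fin n)) (φ : Basis n W₁ → ℂ) :
    oracle G (W₁ ⊕ Σ i, W₂ i) *ᵥ embedFst φ = embedFst (oracle G W₁ *ᵥ φ) := by
  ext ⟨p, q, w | ⟨i, w⟩⟩
  · rw [oracle_mulVec]
    change φ _ = (oracle G W₁ *ᵥ φ) _
    rw [oracle_mulVec]
    rfl
  · rw [oracle_mulVec]
    rfl

theorem oracle_mulVec_embedSnd [Fintype W₁] [Fintype ι] [∀ i, Fintype (W₂ i)]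
    (G : SimpleGraph (Fin n)) (φ : ι → ℂ)
    (χ : ∀ i, Basis n (W₂ i) → ℂ) :
    oracle G (W₁ ⊕ Σ i, W₂ i) *ᵥ embedSnd φ χ = embedSnd φ fun i => oracle G (W₂ i) *ᵥ χ i := by
  ext ⟨p, q, w | ⟨i, w⟩⟩
  · rw [oracle_mulVec]
    rfl
  · rw [oracle_mulVec]
    change φ i * χ i _ = φ i * (oracle G (W₂ i) *ᵥ χ i) _
    rw [oracle_mulVec]
    rfl

variable [Fintype W₁] [DecidableEq W₁] [Fintype ι] [DecidableEq ι]
  [∀ i, Fintype (W₂ i)] [∀ i, DecidableEq (W₂ i)]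

/-- The block diagonal operator on a system whose workspace is a disjoint union. -/
def blockUnitary (U₁ : unitaryGroup (Basis n W₁) ℂ)
    (U₂ : ∀ i, unitaryGroup (Basis n (W₂ i)) ℂ) :
    unitaryGroup (Basis n (W₁ ⊕ Σ i, W₂ i)) ℂ :=
  ⟨reindex basisSumEquiv.symm basisSumEquiv.symm
    (fromBlocks U₁.1 0 0 (blockDiagonal' fun i => (U₂ i).1)), by
    rw [mem_unitaryGroup_iff, star_eq_conjTranspose, conjTranspose_reindex,
      fromBlocks_conjTranspose, blockDiagonal'_conjTranspose, reindex_apply, reindex_apply,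
      submatrix_mul_equiv, fromBlocks_multiply, ← blockDiagonal'_mul]
    have h₁ : U₁.1 * (U₁.1)ᴴ = 1 := mem_unitaryGroup_iff.1 U₁.2
    have h₂ : (fun i => (U₂ i).1 * ((U₂ i).1)ᴴ) = 1 :=
      funext fun i => mem_unitaryGroup_iff.1 (U₂ i).2
    simp only [h₁, h₂, blockDiagonal'_one, conjTranspose_zero, Matrix.mul_zero, Matrix.zero_mul, add_zero,
      zero_add, fromBlocks_one, submatrix_one_equiv]⟩

theorem blockUnitary_mulVec_inl (U₁ : unitaryGroup (Basis n W₁) ℂ)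
    (U₂ : ∀ i, unitaryGroup (Basis n (W₂ i)) ℂ) (ψ : Basis n (W₁ ⊕ Σ i, W₂ i) → ℂ)
    (p : Fin n × Fin n) (q : Bool) (w : W₁) :
    ((blockUnitary U₁ U₂).1 *ᵥ ψ) (p, q, .inl w) =
      (U₁.1 *ᵥ fun b => ψ (b.1, b.2.1, .inl b.2.2)) (p, q, w) := by
  simp only [blockUnitary, mulVec, dotProduct]
  rw [← (basisSumEquiv (n := n) (W₁ := W₁) (W₂ := W₂)).symm.sum_comp]
  simp [Fintype.sum_sum_type, basisSumEquiv]

theorem blockUnitary_mulVec_inr (U₁ : unitaryGroup (Basis n W₁) ℂ)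
    (U₂ : ∀ i, unitaryGroup (Basis n (W₂ i)) ℂ) (ψ : Basis n (W₁ ⊕ Σ i, W₂ i) → ℂ)
    (p : Fin n × Fin n) (q : Bool) (i : ι) (w : W₂ i) :
    ((blockUnitary U₁ U₂).1 *ᵥ ψ) (p, q, .inr ⟨i, w⟩) =
      ((U₂ i).1 *ᵥ fun b => ψ (b.1, b.2.1, .inr ⟨i, b.2.2⟩)) (p, q, w) := by
  simp only [blockUnitary, mulVec, dotProduct]
  rw [← (basisSumEquiv (n := n) (W₁ := W₁) (W₂ := W₂)).symm.sum_comp]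
  simp only [reindex_apply, Equiv.symm_symm, submatrix_apply, Equiv.apply_symm_apply,
    Fintype.sum_sum_type]
  rw [Fintype.sum_sigma, Finset.sum_eq_single i]
  · simp [basisSumEquiv, blockDiagonal'_apply]
  · intro j _ hj
    refine Finset.sum_eq_zero fun b _ => ?_
    simp [basisSumEquiv, blockDiagonal'_apply, Ne.symm hj]
  · simp

theorem blockUnitary_mulVec_embedFst (U₁ : unitaryGroup (Basis n W₁) ℂ)
    (U₂ : ∀ i, unitaryGroup (Basis n (W₂ i)) ℂ) (φ : Basis n W₁ → ℂ) :
    (blockUnitary U₁ U₂).1 *ᵥ embedFst φ = embedFst (U₁.1 *ᵥ φ) := by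
  ext ⟨p, q, w | ⟨i, w⟩⟩
  · rw [blockUnitary_mulVec_inl]; rfl
  · rw [blockUnitary_mulVec_inr]
    change ((U₂ i).1 *ᵥ 0) (p, q, w) = 0
    rw [mulVec_zero, Pi.zero_apply]

theorem blockUnitary_mulVec_embedSnd (U₁ : unitaryGroup (Basis n W₁) ℂ)
    (U₂ : ∀ i, unitaryGroup (Basis n (W₂ i)) ℂ) (φ : ι → ℂ) (χ : ∀ i, Basis n (W₂ i) → ℂ) :
    (blockUnitary U₁ U₂).1 *ᵥ embedSnd φ χ = embedSnd φ fun i => (U₂ i).1 *ᵥ χ i := by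
  ext ⟨p, q, w | ⟨i, w⟩⟩
  · rw [blockUnitary_mulVec_inl]
    change (U₁.1 *ᵥ 0) (p, q, w) = 0
    rw [mulVec_zero, Pi.zero_apply]
  · rw [blockUnitary_mulVec_inr]
    change ((U₂ i).1 *ᵥ (φ i • χ i)) (p, q, w) = φ i * ((U₂ i).1 *ᵥ χ i) (p, q, w)
    rw [mulVec_smul]
    rfl

end Blocks

/-! ### Passing from one algorithm to the next by a permutation of the basis -/

section Handover

variable {W₁ : Type} {V : Basis n W₁ → Type} [∀ b, DecidableEq (V b)]

/-- The permutation that exchanges each basis state `b` of the first block with the basis state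
`c b` of the block with index `b`. -/
def handover (c : ∀ b, Basis n (V b)) :
    Basis n (W₁ ⊕ Σ b, V b) → Basis n (W₁ ⊕ Σ b, V b)
  | (p, q, .inl w) => ((c (p, q, w)).1, (c (p, q, w)).2.1, .inr ⟨(p, q, w), (c (p, q, w)).2.2⟩)
  | (p, q, .inr ⟨b, w⟩) =>
    if (p, q, w) = c b then (b.1, b.2.1, .inl b.2.2) else (p, q, .inr ⟨b, w⟩)

theorem handover_involutive  (c : ∀ b, Basis n (V b)) : Function.Involutive (handover c) := by
  rintro ⟨p, q, w | ⟨b, w⟩⟩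
  · simp [handover]
  · by_cases h : (p, q, w) = c b
    · have h' : handover c (p, q, .inr ⟨b, w⟩) = (b.1, b.2.1, .inl b.2.2) := if_pos h
      rw [h']
      change ((c b).1, (c b).2.1, Sum.inr (⟨b, (c b).2.2⟩ : Σ b, V b)) = _
      rw [← h]
    · have h' : handover c (p, q, .inr ⟨b, w⟩) = (p, q, .inr ⟨b, w⟩) := if_neg h
      rw [h', h']

end Handover

set_option synthInstance.maxSize 2000

section Involution

variable {ι : Type*} [Fintype ι] [DecidableEq ι]

/-- The unitary operator that permutes the basis by an involution. -/
def involutionUnitary {τ : ι → ι} (h : Function.Involutive τ) : unitaryGroup ι ℂ :=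
  ⟨of fun a b => if b = τ a then 1 else 0, by
    rw [mem_unitaryGroup_iff]
    ext a b
    simp [mul_apply, star_apply, h.injective.eq_iff, one_apply, eq_comm, apply_ite]⟩

theorem involutionUnitary_mulVec {τ : ι → ι} (h : Function.Involutive τ) (ψ : ι → ℂ) (a : ι) :
    ((involutionUnitary h).1 *ᵥ ψ) a = ψ (τ a) := by
  simp [involutionUnitary, mulVec, dotProduct]

end Involution

section Handover

variable {W₁ : Type} {V : Basis n W₁ → Type} [∀ b, DecidableEq (V b)]

theorem handover_mulVec_embedFst [Fintype W₁] [DecidableEq W₁] [∀ b, Fintype (V b)]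
    (c : ∀ b, Basis n (V b)) (φ : Basis n W₁ → ℂ) :
    (involutionUnitary (handover_involutive c)).1 *ᵥ embedFst φ =
      embedSnd φ fun b => Pi.single (c b) 1 := by
  ext ⟨p, q, w | ⟨b, w⟩⟩
  · rw [involutionUnitary_mulVec]
    rfl
  · rw [involutionUnitary_mulVec]
    change _ = φ b * (Pi.single (c b) 1 : Basis n (V b) → ℂ) (p, q, w)
    by_cases h : (p, q, w) = c b
    · have h' : handover c (p, q, .inr ⟨b, w⟩) = (b.1, b.2.1, .inl b.2.2) := if_pos h
      rw [h', h, Pi.single_eq_same, mul_one]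
      rfl
    · have h' : handover c (p, q, .inr ⟨b, w⟩) = (p, q, .inr ⟨b, w⟩) := if_neg h
      rw [h', Pi.single_eq_of_ne h, mul_zero]
      rfl

end Handover

/-! ### Sequential composition by deferred measurement -/

namespace Algorithm

variable {α β : Type}

/-- Run an algorithm, and then the algorithm that its output selects. -/
noncomputable def bind (A : Algorithm n α) (T : ℕ) (B : α → Algorithm n β) : Algorithm n β where
  W := A.W ⊕ Σ b : Basis n A.W, (B (A.out b)).W
  queries := A.queries + T
  U t :=
    if t < A.queries then blockUnitary (A.U t) fun _ => 1
    else if t = A.queries then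
      blockUnitary 1 (fun b => (B (A.out b)).U 0) *
        (involutionUnitary (handover_involutive fun b => (B (A.out b)).init) *
          blockUnitary (A.U t) fun _ => 1)
    else blockUnitary 1 fun b => (B (A.out b)).U (t - A.queries)
  init := (A.init.1, A.init.2.1, .inl A.init.2.2)
  out x := match x with
    | (_, _, .inl _) => (B (A.out A.init)).out (B (A.out A.init)).init
    | (p, q, .inr ⟨b, w⟩) => (B (A.out b)).out (p, q, w)

section Bind

variable (A : Algorithm n α) (T : ℕ) (B : α → Algorithm n β) (G : SimpleGraph (Fin n))

/-- `bind` fuses the last unitary of `A` with the handover, so the comparison is made before `U t`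
acts; in this form it still holds at `t = A.queries`. -/
theorem preState_bind_fst (t : ℕ) (ht : t ≤ A.queries) :
    (A.bind T B).preState G t = (embedFst (A.preState G t) :
      Basis n (A.W ⊕ Σ b : Basis n A.W, (B (A.out b)).W) → ℂ) := by
  induction t with
  | zero =>
    have key : ∀ x : Basis n (A.W ⊕ Σ b : Basis n A.W, (B (A.out b)).W),
        (Pi.single (A.init.1, A.init.2.1, .inl A.init.2.2) 1 : _ → ℂ) x =
          embedFst (Pi.single A.init 1) x := by
      rintro ⟨p, q, w | ⟨i, w⟩⟩
      · simp [embedFst, Pi.single_apply, Prod.ext_iff]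
      · simp [embedFst]
    exact funext key
  | succ t ih =>
    have hU : (A.bind T B).U t = blockUnitary (A.U t) fun _ => 1 := if_pos ht
    have hs : (A.bind T B).state G t = (embedFst (A.state G t) :
        Basis n (A.W ⊕ Σ b : Basis n A.W, (B (A.out b)).W) → ℂ) := by
      rw [state_eq_mulVec_preState, state_eq_mulVec_preState, hU, ih (Nat.le_of_succ_le ht)]
      exact blockUnitary_mulVec_embedFst _ _ _
    rw [preState, hs]
    exact oracle_mulVec_embedFst _ _

/-- The handover sends each basis label of `A` to the initial state of its own block. The oracle and
the later unitaries preserve the blocks, so the branches never interfere again, just as after a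
measurement. -/
theorem state_bind_snd (t : ℕ) :
    (A.bind T B).state G (A.queries + t) =
      (embedSnd (A.state G A.queries) fun b => (B (A.out b)).state G t :
        Basis n (A.W ⊕ Σ b : Basis n A.W, (B (A.out b)).W) → ℂ) := by
  induction t with
  | zero =>
    have hU : (A.bind T B).U (A.queries + 0) =
        blockUnitary 1 (fun b => (B (A.out b)).U 0) *
        (involutionUnitary (handover_involutive fun b => (B (A.out b)).init) *
          blockUnitary (A.U A.queries) fun _ => 1) :=
      (if_neg (lt_irrefl _)).trans (if_pos rfl)
    rw [state_eq_mulVec_preState, hU]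
    have h := preState_bind_fst A T B G A.queries le_rfl
    rw [Nat.add_zero, h]
    refine (mulVec_mulVec _ _ _).symm.trans ?_
    refine (congrArg _ ((mulVec_mulVec _ _ _).symm.trans ?_)).trans
      (blockUnitary_mulVec_embedSnd _ _ _ _)
    refine (congrArg _ (blockUnitary_mulVec_embedFst _ _ _)).trans ?_
    rw [← state_eq_mulVec_preState]
    exact handover_mulVec_embedFst _ _
  | succ t ih =>
    have hU : (A.bind T B).U (A.queries + (t + 1)) =
        blockUnitary 1 fun b => (B (A.out b)).U (t + 1) := by
      refine (if_neg (by lia)).trans ((if_neg (by lia)).trans ?_)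
      rw [Nat.add_sub_cancel_left]
    rw [← add_assoc, state, ih]
    rw [add_assoc, hU]
    refine (congrArg _ (oracle_mulVec_embedSnd _ _ _)).trans ?_
    exact blockUnitary_mulVec_embedSnd _ _ _ _

theorem expect_bind (hB : ∀ a, (B a).queries = T) (f : β → ℝ) :
    (A.bind T B).expect G f = A.expect G fun a => (B a).expect G f := by
  have hs := state_bind_snd A T B G T
  simp only [expect]
  have hq : (A.bind T B).queries = A.queries + T := rfl
  rw [hq, hs]
  refine ((basisSumEquiv (n := n) (W₁ := A.W)
    (W₂ := fun b : Basis n A.W => (B (A.out b)).W)).symm.sum_comp _).symm.trans ?_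
  rw [Fintype.sum_sum_type, Fintype.sum_sigma]
  -- After the handover the first block has amplitude zero, so the default output of `bind` there
  -- does not matter.
  have h₀ : ∑ x : Basis n A.W, ‖(embedSnd (A.state G A.queries)
      (fun b => (B (A.out b)).state G T) :
        Basis n (A.W ⊕ Σ b : Basis n A.W, (B (A.out b)).W) → ℂ)
        (basisSumEquiv.symm (.inl x))‖ ^ 2 *
        f ((A.bind T B).out (basisSumEquiv.symm (.inl x))) = 0 := by
    refine Finset.sum_eq_zero fun x _ => ?_
    have : (embedSnd (A.state G A.queries)
      (fun b => (B (A.out b)).state G T) :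
        Basis n (A.W ⊕ Σ b : Basis n A.W, (B (A.out b)).W) → ℂ)
        (basisSumEquiv.symm (.inl x)) = 0 := rfl
    rw [this]
    simp
  refine (congrArg₂ (· + ·) h₀ rfl).trans ((zero_add _).trans ?_)
  refine Finset.sum_congr rfl fun b _ => ?_
  rw [hB, Finset.mul_sum]
  refine Finset.sum_congr rfl fun x _ => ?_
  have : (embedSnd (A.state G A.queries)
      (fun b => (B (A.out b)).state G T) :
        Basis n (A.W ⊕ Σ b : Basis n A.W, (B (A.out b)).W) → ℂ)
        (basisSumEquiv.symm (.inr ⟨b, x⟩)) =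
        A.state G A.queries b * (B (A.out b)).state G T x := rfl
  rw [this, norm_mul, mul_pow, mul_assoc]
  rfl

end Bind

end Algorithm

end QuantumQuery

/-! ### Grover search over a set of pairs -/

namespace QuantumQuery

open Matrix

section Reflection

variable {ι : Type*} [Fintype ι] [DecidableEq ι]

/-- The reflection that negates `v` (the identity if `v = 0`). -/
noncomputable def reflection (v : ι → ℂ) : unitaryGroup ι ℂ :=
  ⟨1 - (2 / (star v ⬝ᵥ v)) • vecMulVec v (star v), by
    have hd : star (star v ⬝ᵥ v) = star v ⬝ᵥ v :=
      (star_dotProduct v v).symm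
    rw [mem_unitaryGroup_iff, star_eq_conjTranspose, conjTranspose_sub, conjTranspose_smul,
      conjTranspose_vecMulVec, star_star, conjTranspose_one, star_div₀, hd, star_ofNat]
    set d := star v ⬝ᵥ v
    have hV : vecMulVec v (star v) * vecMulVec v (star v) = d • vecMulVec v (star v) := by
      rw [vecMulVec_mul_vecMulVec, vecMulVec_smul]
    rw [Matrix.sub_mul, Matrix.mul_sub, Matrix.mul_sub, Matrix.one_mul, Matrix.one_mul,
      Matrix.mul_one, smul_mul_smul_comm, hV, smul_smul]
    have hc : 2 / d * (2 / d) * d = 2 / d + 2 / d := by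
      by_cases h : d = 0
      · simp [h]
      · field_simp
        norm_num
    rw [hc, add_smul]
    abel⟩

theorem reflection_mulVec (v u : ι → ℂ) :
    (reflection v).1 *ᵥ u = u - (2 * (star v ⬝ᵥ u) / (star v ⬝ᵥ v)) • v := by
  simp only [reflection, sub_mulVec, one_mulVec, smul_mulVec, vecMulVec_mulVec]
  ext i
  simp
  ring

-- The reflection along `u - v` exchanges two unit vectors when their inner product is real, which
-- is what `huv` says.
open scoped ComplexOrder in
theorem exists_unitary_mulVec_eq {u v : ι → ℂ} (hu : star u ⬝ᵥ u = 1) (hv : star v ⬝ᵥ v = 1)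
    (huv : star u ⬝ᵥ v = star v ⬝ᵥ u) : ∃ U : unitaryGroup ι ℂ, U.1 *ᵥ u = v := by
  by_cases h : star v ⬝ᵥ u = 1
  · refine ⟨1, ?_⟩
    have : star (u - v) ⬝ᵥ (u - v) = 0 := by
      rw [star_sub, sub_dotProduct, dotProduct_sub, dotProduct_sub, hu, hv, huv, h]
      ring
    rw [dotProduct_star_self_eq_zero] at this
    rw [OneMemClass.coe_one, one_mulVec]
    exact sub_eq_zero.1 this
  · refine ⟨reflection (u - v), ?_⟩
    have h₁ : star (u - v) ⬝ᵥ u = 1 - star v ⬝ᵥ u := by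
      rw [star_sub, sub_dotProduct, hu]
    have h₂ : star (u - v) ⬝ᵥ (u - v) = 2 * (1 - star v ⬝ᵥ u) := by
      rw [star_sub, sub_dotProduct, dotProduct_sub, dotProduct_sub, hu, hv, huv]
      ring
    rw [reflection_mulVec, h₁, h₂, div_self, one_smul, sub_sub_cancel]
    exact mul_ne_zero two_ne_zero (sub_ne_zero.2 (Ne.symm h))

end Reflection

section Grover

variable {n : ℕ}

/-- The pairs in `D` that are edges of `G`. -/
noncomputable def marked (G : SimpleGraph (Fin n)) (D : Finset (Fin n × Fin n)) :
    Finset (Fin n × Fin n) :=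
  D.filter fun x => adjBit G x

/-- A state of the search over `D`: the answer register is in the state `|0⟩ - |1⟩`, the query
register has amplitude `a` at the edges in `D`, and `b` at the other pairs in `D`. -/
noncomputable def searchVec (G : SimpleGraph (Fin n)) (D : Finset (Fin n × Fin n)) (a b : ℝ) :
    Basis n Unit → ℂ :=
  fun x => (((if x.2.1 then -1 else 1) *
    (if x.1 ∈ D then (if adjBit G x.1 then a else b) else 0) : ℝ) : ℂ)

/-- Phase kickback: flipping the answer bit negates `|0⟩ - |1⟩`. -/
theorem oracle_mulVec_searchVec (G : SimpleGraph (Fin n)) (D : Finset (Fin n × Fin n))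
    (a b : ℝ) : oracle G Unit *ᵥ searchVec G D a b = searchVec G D (-a) b := by
  ext ⟨x, q, u⟩
  rw [oracle_mulVec]
  unfold searchVec oracleMap
  congr 1
  by_cases h : adjBit G x <;> cases q <;> simp [h]

theorem star_searchVec_dotProduct (G : SimpleGraph (Fin n)) (D : Finset (Fin n × Fin n))
    (a b a' b' : ℝ) : star (searchVec G D a b) ⬝ᵥ searchVec G D a' b' =
      ((2 * ((marked G D).card * (a * a') + (D.card - (marked G D).card) * (b * b')) : ℝ) : ℂ) := by
  have h : star (searchVec G D a b) ⬝ᵥ searchVec G D a' b' =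
      ((∑ x, (2 * (if x ∈ D then (if adjBit G x then a * a' else b * b') else 0)) : ℝ) : ℂ) := by
    rw [dotProduct, Fintype.sum_prod_type, Complex.ofReal_sum]
    refine Finset.sum_congr rfl fun x _ => ?_
    rw [Fintype.sum_prod_type]
    simp only [Finset.univ_unique, Finset.sum_singleton, Fintype.sum_bool, Pi.star_apply,
      searchVec, RCLike.star_def, Complex.conj_ofReal]
    rw [← Complex.ofReal_mul, ← Complex.ofReal_mul, ← Complex.ofReal_add]
    congr 1
    split_ifs <;> simp <;> ring
  rw [h, ← Finset.mul_sum, Finset.sum_ite_mem, Finset.univ_inter, Finset.sum_ite,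
    Finset.sum_const, Finset.sum_const, nsmul_eq_mul, nsmul_eq_mul, Finset.filter_not, Finset.card_sdiff_of_subset
    (Finset.filter_subset _ _), Nat.cast_sub (Finset.card_le_card (Finset.filter_subset _ _))]
  simp [marked]

variable (D : Finset (Fin n × Fin n))

theorem exists_searchStart (hD : D.Nonempty) (x₀ : Fin n × Fin n) :
    ∃ U : unitaryGroup (Basis n Unit) ℂ, ∀ G : SimpleGraph (Fin n),
      U.1 *ᵥ Pi.single (x₀, false, ()) 1 =
        searchVec G D (√(2 * D.card))⁻¹ (√(2 * D.card))⁻¹ := by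
  set κ : ℝ := (√(2 * D.card))⁻¹ with hκ
  have hN : (0 : ℝ) < D.card := by exact_mod_cast hD.card_pos
  have hκ2 : 2 * D.card * (κ * κ) = 1 := by
    rw [hκ, ← mul_inv, Real.mul_self_sqrt (by positivity)]
    exact mul_inv_cancel₀ (by positivity)
  have hG (G : SimpleGraph (Fin n)) : searchVec G D κ κ = searchVec ⊥ D κ κ := by
    ext x
    simp [searchVec]
  obtain ⟨U, hU⟩ := exists_unitary_mulVec_eq
    (u := (Pi.single (x₀, false, ()) 1 : Basis n Unit → ℂ)) (v := searchVec ⊥ D κ κ)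
    (by simp) (by rw [star_searchVec_dotProduct, ← Complex.ofReal_one, ← hκ2]; congr 1; ring)
    (by simp [searchVec])
  exact ⟨U, fun G => by rw [hG, hU]⟩

/-- Grover's search over `D` with `m` iterations. -/
noncomputable def grover (hD : D.Nonempty) (m : ℕ) : Algorithm n (Fin n × Fin n) where
  W := Unit
  queries := m
  U t := match t with
    | 0 => (exists_searchStart D hD hD.choose).choose
    | _ + 1 => -reflection (searchVec ⊥ D (√(2 * D.card))⁻¹ (√(2 * D.card))⁻¹)
  init := (hD.choose, false, ())
  out b := b.1

/-- In the plane spanned by the uniform vectors on edges and on non-edges, the oracle and the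
reflection are two reflections, and their product rotates by `2θ`. -/
theorem state_grover (hD : D.Nonempty) (m : ℕ) (G : SimpleGraph (Fin n)) {θ : ℝ}
    (hs : Real.sin θ ≠ 0) (hθ : D.card * Real.sin θ ^ 2 = (marked G D).card) (t : ℕ) :
    (grover D hD m).state G t = searchVec G D
      ((√(2 * D.card))⁻¹ * (Real.sin ((2 * t + 1) * θ) / Real.sin θ))
      ((√(2 * D.card))⁻¹ * (Real.cos ((2 * t + 1) * θ) / Real.cos θ)) := by
  set κ : ℝ := (√(2 * D.card))⁻¹ with hκ
  have hN : (0 : ℝ) < D.card := by exact_mod_cast hD.card_pos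
  have hκ2 : 2 * D.card * (κ * κ) = 1 := by
    rw [hκ, ← mul_inv, Real.mul_self_sqrt (by positivity)]
    exact mul_inv_cancel₀ (by positivity)
  have hcos : D.card * Real.cos θ ^ 2 = D.card - (marked G D).card := by
    rw [← hθ, Real.cos_sq']; ring
  -- an amplitude at non-edges is irrelevant if `cos θ = 0`
  have hc {b b' : ℝ} (a : ℝ) (h : Real.cos θ ≠ 0 → b = b') :
      searchVec G D a b = searchVec G D a b' := by
    by_cases h0 : Real.cos θ = 0
    · have hm : marked G D = D := by
        refine Finset.eq_of_subset_of_card_le (Finset.filter_subset _ _) ?_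
        rw [h0] at hcos
        have : (D.card : ℝ) ≤ (marked G D).card := by linarith
        exact_mod_cast this
      ext x
      simp only [searchVec]
      by_cases hx : x.1 ∈ D
      · have : adjBit G x.1 = true := by
          rw [← hm] at hx
          exact (Finset.mem_filter.1 hx).2
        simp [this]
      · simp [hx]
    · rw [h h0]
  have hG : searchVec ⊥ D κ κ = searchVec G D κ κ := by
    ext x
    simp [searchVec]
  induction t with
  | zero =>
    have h : (grover D hD m).state G 0 = searchVec G D κ κ :=
      (exists_searchStart D hD hD.choose).choose_spec G
    rw [h]
    simp only [Nat.cast_zero, mul_zero, zero_add, one_mul, div_self hs, mul_one]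
    exact hc _ fun h => by rw [div_self h, mul_one]
  | succ t ih =>
    have h : (grover D hD m).state G (t + 1) = (-(reflection (searchVec ⊥ D κ κ)).1) *ᵥ
        (oracle G Unit *ᵥ (grover D hD m).state G t) := rfl
    rw [h, ih]
    rw [oracle_mulVec_searchVec, neg_mulVec, reflection_mulVec, hG,
      star_searchVec_dotProduct, star_searchVec_dotProduct]
    set S := Real.sin ((2 * t + 1) * θ)
    set K := Real.cos ((2 * t + 1) * θ)
    have e : ((2 * (t + 1 : ℕ) + 1 : ℝ)) * θ = (2 * t + 1) * θ + 2 * θ := by push_cast; ring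
    rw [e, Real.sin_add, Real.cos_add, Real.sin_two_mul, Real.cos_two_mul]
    -- The overlap of the queried state with the start vector is `cos ((2t + 2)θ)`, here in expanded
    -- form.
    have h₁ : (2 * ((marked G D).card * (κ * -(κ * (S / Real.sin θ))) +
        (D.card - (marked G D).card) * (κ * (κ * (K / Real.cos θ)))) : ℝ) =
        K * Real.cos θ - S * Real.sin θ := by
      rw [← hcos, ← hθ]
      have h1 : Real.sin θ ^ 2 * (S / Real.sin θ) = S * Real.sin θ := by field_simp
      have h2 : Real.cos θ ^ 2 * (K / Real.cos θ) = K * Real.cos θ := by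
        by_cases h0 : Real.cos θ = 0
        · simp [h0]
        · field_simp
      linear_combination (K * Real.cos θ - S * Real.sin θ) * hκ2 - 2 * D.card * (κ * κ) * h1 +
        2 * D.card * (κ * κ) * h2
    have h₂ : (2 * ((marked G D).card * (κ * κ) +
        (D.card - (marked G D).card) * (κ * κ)) : ℝ) = 1 := by
      rw [← hκ2]; ring
    rw [h₁, h₂]
    set μ := K * Real.cos θ - S * Real.sin θ
    trans searchVec G D (2 * μ * κ + κ * (S / Real.sin θ)) (2 * μ * κ - κ * (K / Real.cos θ))
    · ext x
      simp only [searchVec, Pi.neg_apply, Pi.sub_apply, Pi.smul_apply, smul_eq_mul]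
      push_cast
      split_ifs <;> push_cast <;> ring
    · have hsq : Real.sin θ ^ 2 + Real.cos θ ^ 2 = 1 := Real.sin_sq_add_cos_sq θ
      have : 2 * μ * κ + κ * (S / Real.sin θ) =
          κ * ((S * (2 * Real.cos θ ^ 2 - 1) + K * (2 * Real.sin θ * Real.cos θ)) /
            Real.sin θ) := by
        simp only [μ]
        field_simp
        linear_combination (-2 * S * κ) * hsq
      rw [this]
      refine hc _ fun h0 => ?_
      simp only [μ]
      field_simp
      ring

theorem expect_grover_marked (hD : D.Nonempty) (m : ℕ) (G : SimpleGraph (Fin n)) {θ : ℝ}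
    (hs : Real.sin θ ≠ 0) (hθ : D.card * Real.sin θ ^ 2 = (marked G D).card) :
    (grover D hD m).expect G (fun x => if x ∈ marked G D then 1 else 0) =
      Real.sin ((2 * m + 1) * θ) ^ 2 := by
  have hN : (0 : ℝ) < D.card := by exact_mod_cast hD.card_pos
  have hst := state_grover D hD m G hs hθ m
  set κ : ℝ := (√(2 * D.card))⁻¹ with hκ
  have hκ2 : 2 * D.card * (κ * κ) = 1 := by
    rw [hκ, ← mul_inv, Real.mul_self_sqrt (by positivity)]
    exact mul_inv_cancel₀ (by positivity)
  set a := κ * (Real.sin ((2 * m + 1) * θ) / Real.sin θ) with ha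
  have key : (grover D hD m).expect G (fun x => if x ∈ marked G D then 1 else 0) =
      ∑ x ∈ marked G D, 2 * a ^ 2 := by
    rw [Algorithm.expect]
    change ∑ b : Basis n Unit, ‖(grover D hD m).state G m b‖ ^ 2 *
      (if b.1 ∈ marked G D then 1 else 0) = _
    rw [hst, Fintype.sum_prod_type, ← Finset.univ_inter (marked G D), ← Finset.sum_ite_mem]
    refine Finset.sum_congr rfl fun x _ => ?_
    rw [Fintype.sum_prod_type]
    simp only [Finset.univ_unique, Finset.sum_singleton, Fintype.sum_bool, searchVec]
    by_cases hx : x ∈ marked G D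
    · obtain ⟨h1, h2⟩ := Finset.mem_filter.1 hx
      simp [hx, h1, h2]
      ring
    · simp [hx]
  rw [key, Finset.sum_const, nsmul_eq_mul, ← hθ, ha]
  field_simp
  linear_combination Real.sin ((2 * m + 1) * θ) ^ 2 * hκ2

end Grover

end QuantumQuery

/-! ### Verified attempts and runs of attempts -/

namespace QuantumQuery

section Search

variable {n : ℕ} {σ : Type}

theorem Algorithm.expect_constOut (T : ℕ) (x₀ : Fin n × Fin n) (s : σ) (G : SimpleGraph (Fin n))
    (f : σ → ℝ) : (Algorithm.query T x₀ fun _ => s).expect G f = f s :=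
  Algorithm.expect_const (Algorithm.query T x₀ fun _ => s) G (f s)

variable (x₀ : Fin n × Fin n) (D : σ → Finset (Fin n × Fin n)) (upd : σ → Fin n × Fin n → σ)

/-- In state `s`, search for an edge in `D s` with `m` iterations, and update the state if one is
found. -/
noncomputable def attempt (m : ℕ) (s : σ) : Algorithm n σ :=
  if h : (D s).Nonempty then
    (grover (D s) h m).bind 1 fun x =>
      Algorithm.query 1 x fun b => if b = true ∧ x ∈ D s then upd s x else s
  else Algorithm.query (m + 1) x₀ fun _ => s

theorem queries_attempt (m : ℕ) (s : σ) : (attempt x₀ D upd m s).queries = m + 1 := by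
  unfold attempt
  split <;> rfl

theorem expect_attempt (m : ℕ) (s : σ) (h : (D s).Nonempty) (G : SimpleGraph (Fin n))
    (f : σ → ℝ) : (attempt x₀ D upd m s).expect G f =
      (grover (D s) h m).expect G fun x => f (if x ∈ marked G (D s) then upd s x else s) := by
  rw [attempt, dif_pos h, Algorithm.expect_bind _ 1 (fun x =>
    Algorithm.query 1 x fun b => if b = true ∧ x ∈ D s then upd s x else s) _ fun _ => rfl]
  simp only [Algorithm.expect_query_one, marked, Finset.mem_filter, and_comm]

-- The final query of an attempt checks the pair, so only `s` and its updates by genuine edges are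
-- reachable.
variable {x₀ D upd} in
theorem expect_attempt_mono {G : SimpleGraph (Fin n)} {m : ℕ} {s : σ} {f g : σ → ℝ}
    (hs : f s ≤ g s) (hx : ∀ x ∈ marked G (D s), f (upd s x) ≤ g (upd s x)) :
    (attempt x₀ D upd m s).expect G f ≤ (attempt x₀ D upd m s).expect G g := by
  by_cases h : (D s).Nonempty
  · rw [expect_attempt _ _ _ _ _ h, expect_attempt _ _ _ _ _ h]
    refine Algorithm.expect_mono _ _ fun x => ?_
    split
    · exact hx x ‹_›
    · exact hs
  · rw [attempt, dif_neg h, Algorithm.expect_constOut, Algorithm.expect_constOut]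
    exact hs

/-- The angle of the search over `D`. -/
noncomputable def searchAngle (G : SimpleGraph (Fin n)) (D : Finset (Fin n × Fin n)) : ℝ :=
  Real.arcsin √((marked G D).card / D.card)

theorem sin_searchAngle (G : SimpleGraph (Fin n)) (D : Finset (Fin n × Fin n)) :
    Real.sin (searchAngle G D) = √((marked G D).card / D.card) := by
  refine Real.sin_arcsin (by linarith [Real.sqrt_nonneg ((marked G D).card / D.card : ℝ)]) ?_
  refine Real.sqrt_le_one.2 ?_
  refine div_le_one_of_le₀ ?_ (Nat.cast_nonneg _)
  exact_mod_cast Finset.card_le_card (Finset.filter_subset _ _)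

-- Here `f` plays the role of a failure probability that vanishes once an edge is found. Pointwise,
-- `f` plus the indicator of success is at most `1`, and success has probability at least `1/4`.
variable {x₀ D upd} in
theorem expect_attempt_le {G : SimpleGraph (Fin n)} {m : ℕ} {s : σ} {f : σ → ℝ}
    (hm : (marked G (D s)).Nonempty)
    (hθ : 1 / 4 ≤ Real.sin ((2 * m + 1) * searchAngle G (D s)) ^ 2)
    (hs : f s ≤ 1) (hx : ∀ x ∈ marked G (D s), f (upd s x) ≤ 0) :
    (attempt x₀ D upd m s).expect G f ≤ 3 / 4 := by
  have h : (D s).Nonempty := hm.mono (Finset.filter_subset _ _)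
  have hd : (0 : ℝ) < (D s).card := by exact_mod_cast h.card_pos
  have ht : (0 : ℝ) < (marked G (D s)).card := by exact_mod_cast hm.card_pos
  have hsin := sin_searchAngle G (D s)
  have h₀ : Real.sin (searchAngle G (D s)) ≠ 0 := by
    rw [hsin]
    positivity
  have h₁ := expect_grover_marked (D s) h m G h₀ (by
    rw [hsin, Real.sq_sqrt (by positivity)]
    field_simp)
  rw [expect_attempt _ _ _ _ _ h]
  have h₂ : (grover (D s) h m).expect G (fun x => f (if x ∈ marked G (D s) then upd s x else s)) +
      (grover (D s) h m).expect G (fun x => if x ∈ marked G (D s) then 1 else 0) ≤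
      (grover (D s) h m).expect G fun _ => 1 := by
    rw [← Algorithm.expect_add]
    refine Algorithm.expect_mono _ _ fun x => ?_
    split
    · linarith [hx x ‹_›]
    · linarith
  rw [Algorithm.expect_const, h₁] at h₂
  linarith

/-- The number of queries of a sequence of attempts with the given numbers of iterations. -/
def cost (ms : List ℕ) : ℕ := (ms.map (· + 1)).sum

theorem cost_append (l₁ l₂ : List ℕ) : cost (l₁ ++ l₂) = cost l₁ + cost l₂ := by
  simp [cost]

theorem cost_flatten_replicate (c : ℕ) (ms : List ℕ) :
    cost (List.replicate c ms).flatten = c * cost ms := by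
  induction c with
  | zero => simp [cost]
  | succ c ih => rw [List.replicate_succ, List.flatten_cons, cost_append, ih]; ring

/-- A sequence of attempts with the given numbers of iterations. -/
noncomputable def run : List ℕ → σ → Algorithm n σ
  | [], s => Algorithm.query 0 x₀ fun _ => s
  | m :: ms, s => (attempt x₀ D upd m s).bind (cost ms) (run ms)

theorem queries_run (ms : List ℕ) (s : σ) : (run x₀ D upd ms s).queries = cost ms := by
  cases ms with
  | nil => rfl
  | cons m ms =>
    change (attempt x₀ D upd m s).queries + cost ms = cost (m :: ms)
    simp [queries_attempt, cost]

theorem expect_run_nil (s : σ) (G : SimpleGraph (Fin n)) (f : σ → ℝ) :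
    (run x₀ D upd [] s).expect G f = f s :=
  Algorithm.expect_constOut _ _ _ _ _

theorem expect_run_cons (m : ℕ) (ms : List ℕ) (s : σ) (G : SimpleGraph (Fin n)) (f : σ → ℝ) :
    (run x₀ D upd (m :: ms) s).expect G f =
      (attempt x₀ D upd m s).expect G fun s' => (run x₀ D upd ms s').expect G f :=
  Algorithm.expect_bind _ _ _ _ (queries_run x₀ D upd ms) _

theorem expect_run_append (l₁ l₂ : List ℕ) (s : σ) (G : SimpleGraph (Fin n)) (f : σ → ℝ) :
    (run x₀ D upd (l₁ ++ l₂) s).expect G f =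
      (run x₀ D upd l₁ s).expect G fun s' => (run x₀ D upd l₂ s').expect G f := by
  induction l₁ generalizing s with
  | nil => rw [expect_run_nil, List.nil_append]
  | cons m l ih =>
    rw [List.cons_append, expect_run_cons, expect_run_cons]
    simp only [ih]

variable {x₀ D upd}

/-- Invariants hold with certainty, since unverified pairs never change the state; hence comparing
`f` and `g` under `P` suffices. -/
theorem expect_run_mono {G : SimpleGraph (Fin n)} {P : σ → Prop}
    (hP : ∀ s, P s → ∀ x ∈ marked G (D s), P (upd s x)) {f g : σ → ℝ}
    (h : ∀ s, P s → f s ≤ g s) (ms : List ℕ) {s : σ} (hs : P s) :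
    (run x₀ D upd ms s).expect G f ≤ (run x₀ D upd ms s).expect G g := by
  induction ms generalizing s with
  | nil =>
    rw [expect_run_nil, expect_run_nil]
    exact h s hs
  | cons m ms ih =>
    rw [expect_run_cons, expect_run_cons]
    exact expect_attempt_mono (ih hs) fun x hx => ih (hP s hs x hx)

theorem expect_run_le {G : SimpleGraph (Fin n)} {P : σ → Prop}
    (hP : ∀ s, P s → ∀ x ∈ marked G (D s), P (upd s x)) {f : σ → ℝ} {c : ℝ}
    (h : ∀ s, P s → f s ≤ c) (ms : List ℕ) {s : σ} (hs : P s) :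
    (run x₀ D upd ms s).expect G f ≤ c :=
  (expect_run_mono hP h ms hs).trans_eq (Algorithm.expect_const _ _ _)

/-! ### Potentials and the drift argument -/

variable (D upd) in
/-- While the invariant `I` holds, `r` decreases with each edge that is found, at least `r` edges
can be found, and the search space has at most `N` elements. -/
structure IsPotential (G : SimpleGraph (Fin n)) (N : ℕ) (I : σ → Prop) (r : σ → ℕ) : Prop where
  inv : ∀ s, I s → ∀ x ∈ marked G (D s), I (upd s x)
  lt : ∀ s, I s → ∀ x ∈ marked G (D s), r (upd s x) < r s
  le_card : ∀ s, I s → r s ≤ (marked G (D s)).card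
  card_le : ∀ s, (D s).card ≤ N

namespace IsPotential

variable {G : SimpleGraph (Fin n)} {N : ℕ} {I : σ → Prop} {r : σ → ℕ}

theorem inv_and_lt (h : IsPotential D upd G N I r) (ρ : ℕ) (s : σ) (hs : I s ∧ r s < ρ) :
    ∀ x ∈ marked G (D s), I (upd s x) ∧ r (upd s x) < ρ :=
  fun x hx => ⟨h.inv s hs.1 x hx, (h.lt s hs.1 x hx).trans hs.2⟩

/-- One good number of iterations is enough: the attempts before it either leave `s` unchanged or
have already lowered `r`, and `r` never grows back. -/
theorem expect_run_le_of_mem (h : IsPotential D upd G N I r) {s : σ} (hs : I s)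
    (hr : 0 < r s) {m : ℕ} (hθ : 1 / 4 ≤ Real.sin ((2 * m + 1) * searchAngle G (D s)) ^ 2)
    {ms : List ℕ} (hm : m ∈ ms) :
    (run x₀ D upd ms s).expect G (fun s' => if r s ≤ r s' then 1 else 0) ≤ 3 / 4 := by
  have hpos : (marked G (D s)).Nonempty := Finset.card_pos.1 (hr.trans_le (h.le_card s hs))
  have hle (ms : List ℕ) : ∀ x ∈ marked G (D s), (run x₀ D upd ms (upd s x)).expect G
      (fun s' => if r s ≤ r s' then 1 else 0) ≤ 0 := fun x hx =>
    expect_run_le (P := fun s' => I s' ∧ r s' < r s) (h.inv_and_lt _)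
      (fun s' hs' => by rw [if_neg (not_le.2 hs'.2)]) ms ⟨h.inv s hs x hx, h.lt s hs x hx⟩
  induction ms with
  | nil => simp at hm
  | cons m' ms ih =>
    rw [expect_run_cons]
    rcases List.mem_cons.1 hm with rfl | hm
    · refine expect_attempt_le (f := fun s' => (run x₀ D upd ms s').expect G
        fun s' => if r s ≤ r s' then 1 else 0) hpos hθ ?_ fun x hx => hle ms x hx
      exact expect_run_le (P := fun _ => True) (fun _ _ _ _ => trivial)
        (fun s' _ => by split <;> norm_num) ms trivial
    · refine (expect_attempt_mono (f := fun s' => (run x₀ D upd ms s').expect G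
        fun s' => if r s ≤ r s' then 1 else 0) (g := fun _ => 3 / 4) (ih hm) fun x hx => ?_).trans_eq
        (Algorithm.expect_const _ _ _)
      exact (hle ms x hx).trans (by norm_num)

/-- While `r ≥ R`, each repetition of `ms` lowers `r` by at least `1/4` on average, so the expected
number of repetitions begun in this range is at most `4 * r s`. The range is never re-entered, so
this number is at least `c` times the probability of remaining in it. -/
theorem mul_expect_run_le (h : IsPotential D upd G N I r) {R : ℕ} {ms : List ℕ}
    (hms : ∀ s, I s → R ≤ r s →
      (run x₀ D upd ms s).expect G (fun s' => if r s ≤ r s' then 1 else 0) ≤ 3 / 4)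
    (c : ℕ) {s : σ} (hs : I s) :
    c * (run x₀ D upd (List.replicate c ms).flatten s).expect G
      (fun s' => if R ≤ r s' then 1 else 0) ≤ 4 * r s := by
  induction c generalizing s with
  | zero => simp
  | succ c ih =>
    rw [List.replicate_succ, List.flatten_cons, expect_run_append]
    set g : σ → ℝ := fun s' => (run x₀ D upd (List.replicate c ms).flatten s').expect G
      (fun s' => if R ≤ r s' then 1 else 0)
    have hg (s' : σ) : g s' ≤ 1 :=
      expect_run_le (P := fun _ => True) (by simp) (fun s' _ => by split <;> simp) _ trivial
    by_cases hR : R ≤ r s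
    · have h₁ : (run x₀ D upd ms s).expect G g ≤ 1 :=
        expect_run_le (P := fun _ => True) (by simp) (fun s' _ => hg s') _ trivial
      have h₂ : (c : ℝ) * (run x₀ D upd ms s).expect G g ≤ 4 * r s - 1 := by
        -- The right side has expectation at most `4 (r - 1) + 4 · 3/4 = 4 r - 1`; the spare `1`
        -- pays for passing from `c` to `c + 1`.
        have h₃ : (run x₀ D upd ms s).expect G (fun s' => c * g s') ≤
            (run x₀ D upd ms s).expect G
              (fun s' => 4 * (r s - 1) + 4 * (if r s ≤ r s' then 1 else 0)) := by
          refine expect_run_mono (P := fun s' => I s' ∧ r s' < r s + 1) (h.inv_and_lt _) ?_ ms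
            ⟨hs, Nat.lt_succ_self _⟩
          rintro s' ⟨hI, hr⟩
          refine (ih hI).trans ?_
          split
          · have : (r s' : ℝ) ≤ r s := by exact_mod_cast Nat.le_of_lt_succ hr
            linarith
          · have : (r s' : ℝ) + 1 ≤ r s := by exact_mod_cast (by lia : r s' + 1 ≤ r s)
            linarith
        rw [Algorithm.expect_add, Algorithm.expect_const, Algorithm.expect_const_mul,
          Algorithm.expect_const_mul] at h₃
        linarith [hms s hs hR]
      push_cast
      linarith
    · have h₁ : (run x₀ D upd ms s).expect G g ≤ 0 := by
        refine expect_run_le (P := fun s' => I s' ∧ r s' < R) (h.inv_and_lt _) ?_ ms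
          ⟨hs, not_le.1 hR⟩
        intro s' hs'
        exact expect_run_le (P := fun s' => I s' ∧ r s' < R) (h.inv_and_lt _)
          (fun s' hs' => by rw [if_neg (not_le.2 hs'.2)]) _ hs'
      have h₂ : ((c + 1 : ℕ) : ℝ) * (run x₀ D upd ms s).expect G g ≤ 0 :=
        mul_nonpos_of_nonneg_of_nonpos (Nat.cast_nonneg _) h₁
      exact h₂.trans (by positivity)

end IsPotential

/-! ### A schedule with `O(√(NK))` queries -/

/-- Numbers of iterations one of which is good for each angle that is not too small. -/
def block : ℕ → List ℕ
  | 0 => [0, 1]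
  | l + 1 => block l ++ [2 ^ (l + 1)]

theorem cost_block_le (l : ℕ) : cost (block l) ≤ 4 * 2 ^ l := by
  induction l with
  | zero => simp [cost, block]
  | succ l ih =>
    have h : cost [2 ^ (l + 1)] = 2 ^ (l + 1) + 1 := by simp [cost]
    have := Nat.one_le_two_pow (n := l)
    rw [block, cost_append, h, pow_succ]
    lia

theorem one_div_four_le_sin_sq {x : ℝ} (h₁ : Real.pi / 6 ≤ x) (h₂ : x ≤ Real.pi / 2) :
    1 / 4 ≤ Real.sin x ^ 2 := by
  have h := Real.sin_le_sin_of_le_of_le_pi_div_two (by linarith [Real.pi_pos]) h₂ h₁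
  rw [Real.sin_pi_div_six] at h
  nlinarith

/-- From one entry of the block to the next, `2m + 1` grows by a factor of at most `3`, so the
multiples of `θ` cannot jump over the window from `π/6` to `π/2`. -/
theorem exists_mem_block {θ : ℝ} (h₀ : 0 ≤ θ) (h₁ : θ ≤ Real.pi / 2) (l : ℕ)
    (h : Real.pi / 6 ≤ (2 * 2 ^ l + 1) * θ) :
    ∃ m ∈ block l, 1 / 4 ≤ Real.sin ((2 * (m : ℝ) + 1) * θ) ^ 2 := by
  induction l with
  | zero =>
    by_cases h' : Real.pi / 6 ≤ θ
    · exact ⟨0, by simp [block], one_div_four_le_sin_sq (by simpa using h') (by simpa using h₁)⟩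
    · refine ⟨1, by simp [block], one_div_four_le_sin_sq ?_ ?_⟩
      · simpa using h
      · push_cast
        linarith
  | succ l ih =>
    by_cases h' : Real.pi / 6 ≤ (2 * 2 ^ l + 1) * θ
    · obtain ⟨m, hm, hθ⟩ := ih h'
      exact ⟨m, List.mem_append_left _ hm, hθ⟩
    · refine ⟨2 ^ (l + 1), by simp [block], one_div_four_le_sin_sq ?_ ?_⟩
      · exact_mod_cast h
      · push_cast
        rw [pow_succ]
        have : 0 ≤ 2 ^ l * θ := by positivity
        linarith

/-- At least `r s` of at most `N` pairs are edges, so `sin θ ≥ 2^(-l)`, and `sin θ ≤ θ` makes the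
angle large enough for the block. -/
theorem IsPotential.expect_run_block_le {G : SimpleGraph (Fin n)} {N : ℕ} {I : σ → Prop}
    {r : σ → ℕ} (h : IsPotential D upd G N I r) (hN : 0 < N) {l : ℕ} {s : σ} (hs : I s)
    (hl : N ≤ 4 ^ l * r s) :
    (run x₀ D upd (block l) s).expect G (fun s' => if r s ≤ r s' then 1 else 0) ≤ 3 / 4 := by
  have hr : 0 < r s := Nat.pos_of_ne_zero fun h0 => by simp [h0] at hl; lia
  have hpos : 0 < (marked G (D s)).card := hr.trans_le (h.le_card s hs)
  have hd : 0 < (D s).card := hpos.trans_le (Finset.card_le_card (Finset.filter_subset _ _))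
  have hθ₀ : 0 ≤ searchAngle G (D s) := Real.arcsin_nonneg.2 (Real.sqrt_nonneg _)
  have hle : 1 ≤ 2 ^ l * searchAngle G (D s) := by
    refine le_trans ?_ (mul_le_mul_of_nonneg_left (Real.sin_le hθ₀) (by positivity))
    rw [sin_searchAngle, ← Real.sqrt_sq (x := 2 ^ l) (by positivity),
      ← Real.sqrt_mul (by positivity), Real.one_le_sqrt, ← pow_mul, mul_comm l 2, pow_mul,
      mul_div_assoc', one_le_div (by exact_mod_cast hd)]
    have : (D s).card ≤ 4 ^ l * (marked G (D s)).card :=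
      (h.card_le s).trans (hl.trans (Nat.mul_le_mul_left _ (h.le_card s hs)))
    norm_num
    exact_mod_cast this
  obtain ⟨m, hm, hθ⟩ := exists_mem_block hθ₀ (Real.arcsin_le_pi_div_two _) l (by
    linarith [Real.pi_le_four])
  exact h.expect_run_le_of_mem hs hr hθ hm

/-- `a * 16 ^ i` repetitions of attempts that can find one of `16 ^ i` edges among `4 ^ M`
pairs. -/
def stage (M i a : ℕ) : List ℕ := (List.replicate (a * 16 ^ i) (block (M - 2 * i))).flatten

/-- The stages for decreasing numbers of edges that remain to be found. -/
def stages (M : ℕ) : ℕ → ℕ → List ℕ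
  | 0, a => stage M 0 a
  | i + 1, a => stage M (i + 1) a ++ stages M i (2 * a)

theorem IsPotential.expect_run_stage_le {G : SimpleGraph (Fin n)} {N : ℕ} {I : σ → Prop}
    {r : σ → ℕ} (h : IsPotential D upd G N I r) (hN : 0 < N) {M : ℕ} (hM : N ≤ 4 ^ M) (i : ℕ)
    {a : ℕ} (ha : 0 < a) {s : σ} (hs : I s) (hr : r s < 16 ^ (i + 1)) :
    (run x₀ D upd (stage M i a) s).expect G (fun s' => if 16 ^ i ≤ r s' then 1 else 0) ≤
      64 / a := by
  have h₁ := h.mul_expect_run_le (x₀ := x₀) (R := 16 ^ i) (ms := block (M - 2 * i))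
    (fun s hs hR => h.expect_run_block_le hN hs (by
      calc N ≤ 4 ^ M := hM
        _ ≤ 4 ^ (M - 2 * i + 2 * i) := Nat.pow_le_pow_right (by norm_num) (by lia)
        _ = 4 ^ (M - 2 * i) * 16 ^ i := by rw [pow_add, pow_mul 4 2]; norm_num
        _ ≤ _ := Nat.mul_le_mul_left _ hR)) (a * 16 ^ i) hs
  have h₂ : (r s : ℝ) ≤ 16 ^ i * 16 := by
    rw [← pow_succ]
    exact_mod_cast hr.le
  have ha' : (0 : ℝ) < a := by exact_mod_cast ha
  rw [le_div_iff₀ ha', mul_comm]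
  have hp : (0 : ℝ) < 16 ^ i := by positivity
  push_cast at h₁
  refine le_of_mul_le_mul_left ?_ hp
  rw [stage]
  linarith

/-- The first stage fails with probability at most `64 / a`; the remaining ones use `2 * a` and by
induction fail with at most `128 / (2a) = 64 / a`. -/
theorem IsPotential.expect_run_stages_le {G : SimpleGraph (Fin n)} {N : ℕ} {I : σ → Prop}
    {r : σ → ℕ} (h : IsPotential D upd G N I r) (hN : 0 < N) {M : ℕ} (hM : N ≤ 4 ^ M) (i : ℕ)
    {a : ℕ} (ha : 0 < a) {s : σ} (hs : I s) (hr : r s < 16 ^ (i + 1)) :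
    (run x₀ D upd (stages M i a) s).expect G (fun s' => if 1 ≤ r s' then 1 else 0) ≤
      128 / a := by
  have ha' : (0 : ℝ) < a := by exact_mod_cast ha
  induction i generalizing a s with
  | zero =>
    have := h.expect_run_stage_le (x₀ := x₀) hN hM 0 ha hs hr
    rw [pow_zero] at this
    exact this.trans (by gcongr; norm_num)
  | succ i ih =>
    rw [stages, expect_run_append]
    have h₁ : (run x₀ D upd (stage M (i + 1) a) s).expect G (fun s' =>
          (run x₀ D upd (stages M i (2 * a)) s').expect G (fun s' => if 1 ≤ r s' then 1 else 0)) ≤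
        (run x₀ D upd (stage M (i + 1) a) s).expect G
          (fun s' => (if 16 ^ (i + 1) ≤ r s' then 1 else 0) + 64 / a) := by
      refine expect_run_mono (P := I) h.inv (fun s' hs' => ?_) _ hs
      split
      · have : (run x₀ D upd (stages M i (2 * a)) s').expect G
            (fun s' => if 1 ≤ r s' then 1 else 0) ≤ 1 :=
          expect_run_le (P := fun _ => True) (by simp) (fun s' _ => by split <;> simp) _ trivial
        have : (0 : ℝ) ≤ 64 / a := by positivity
        linarith
      · refine (ih (a := 2 * a) (by lia) hs' (not_le.1 ‹_›) (by positivity)).trans_eq ?_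
        push_cast
        field_simp
        norm_num
    rw [Algorithm.expect_add, Algorithm.expect_const] at h₁
    have h₂ := h.expect_run_stage_le (x₀ := x₀) hN hM (i + 1) ha hs hr
    have h₃ : (128 : ℝ) / a = 64 / a + 64 / a := by ring
    linarith

theorem cost_stage_le {N M i : ℕ} (hM : 4 ^ M ≤ 4 * N) (hi : 16 ^ i ≤ N) (a : ℕ) :
    (cost (stage M i a) : ℝ) ≤ 8 * a * 4 ^ i * √N := by
  have h₁ : ((4 ^ i * 2 ^ (M - 2 * i) : ℕ) : ℝ) ≤ 2 * √N := by
    refine (Real.le_sqrt_of_sq_le ?_).trans_eq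
      (by rw [Real.sqrt_mul (by norm_num)]; norm_num : √(4 * N) = 2 * √N)
    have : (4 ^ i * 2 ^ (M - 2 * i)) ^ 2 = 4 ^ (2 * i + (M - 2 * i)) := by
      rw [mul_pow, ← pow_mul, ← pow_mul, pow_add, mul_comm i, mul_comm _ 2, pow_mul 2 2]
      norm_num
    norm_cast
    rw [this]
    -- If `2 * i` exceeds `M`, the subtraction truncates to `0`, and `16 ^ i ≤ N` takes over.
    rcases le_total (2 * i) M with h | h
    · rwa [Nat.add_sub_cancel' h]
    · rw [Nat.sub_eq_zero_of_le h, add_zero, pow_mul]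
      exact hi.trans (by lia)
  have h₂ : (cost (stage M i a) : ℝ) ≤ ((a * 16 ^ i * (4 * 2 ^ (M - 2 * i)) : ℕ) : ℝ) := by
    rw [stage, cost_flatten_replicate]
    exact_mod_cast Nat.mul_le_mul_left _ (cost_block_le _)
  have h₃ : ((a * 16 ^ i * (4 * 2 ^ (M - 2 * i)) : ℕ) : ℝ) =
      4 * a * 4 ^ i * ((4 ^ i * 2 ^ (M - 2 * i) : ℕ) : ℝ) := by
    have : (16 : ℝ) ^ i = 4 ^ i * 4 ^ i := by rw [← mul_pow]; norm_num
    push_cast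
    rw [this]
    ring
  calc _ ≤ _ := h₂
    _ = _ := h₃
    _ ≤ 4 * a * 4 ^ i * (2 * √N) := by gcongr
    _ = _ := by ring

/-- As `i` drops by one, `4 ^ i` shrinks by `4` while `a` only doubles, so the costs halve and the
first stage dominates. This is why the stages use base `16`. -/
theorem cost_stages_le {N M i : ℕ} (hM : 4 ^ M ≤ 4 * N) (hi : 16 ^ i ≤ N) (a : ℕ) :
    (cost (stages M i a) : ℝ) ≤ 16 * a * 4 ^ i * √N := by
  induction i generalizing a with
  | zero =>
    refine (cost_stage_le hM hi a).trans ?_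
    gcongr
    norm_num
  | succ i ih =>
    have h₁ := ih ((Nat.pow_le_pow_right (by norm_num) (Nat.le_succ i)).trans hi) (2 * a)
    have h₂ := cost_stage_le hM hi a
    rw [stages, cost_append]
    push_cast at h₁ ⊢
    rw [pow_succ] at h₂ ⊢
    linarith

/-- Numbers of iterations for finding `K` edges among `N` pairs. -/
def schedule (N K : ℕ) : List ℕ := stages (Nat.log 4 N + 1) (Nat.log 16 K) 768

theorem cost_schedule_le {N K : ℕ} (hK : 0 < K) (hKN : K ≤ N) :
    (cost (schedule N K) : ℝ) ≤ 12288 * √(N * K) := by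
  have h₁ : 4 ^ (Nat.log 4 N + 1) ≤ 4 * N := by
    rw [pow_succ, mul_comm]
    exact Nat.mul_le_mul_left _ (Nat.pow_log_le_self 4 (by lia))
  have h₂ : 16 ^ Nat.log 16 K ≤ K := Nat.pow_log_le_self 16 (by lia)
  refine (cost_stages_le h₁ (h₂.trans hKN) 768).trans ?_
  have h₃ : (4 : ℝ) ^ Nat.log 16 K ≤ √K := by
    refine Real.le_sqrt_of_sq_le ?_
    rw [← pow_mul, mul_comm, pow_mul]
    norm_num
    exact_mod_cast h₂
  rw [Real.sqrt_mul (Nat.cast_nonneg N)]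
  calc (16 * (768 : ℕ) * 4 ^ Nat.log 16 K * √N : ℝ) ≤ 16 * (768 : ℕ) * √K * √N := by gcongr
    _ = _ := by push_cast; ring

/-- The effort `768` in `schedule` is chosen so that `128 / 768 = 1 / 6`; two phases then fail with
total probability at most `1 / 3`. -/
theorem IsPotential.expect_run_schedule_le {G : SimpleGraph (Fin n)} {N K : ℕ} {I : σ → Prop}
    {r : σ → ℕ} (h : IsPotential D upd G N I r) (hN : 0 < N) {s : σ} (hs : I s) (hr : r s ≤ K) :
    (run x₀ D upd (schedule N K) s).expect G (fun s' => if 1 ≤ r s' then 1 else 0) ≤ 1 / 6 :=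
  (h.expect_run_stages_le hN (Nat.lt_pow_succ_log_self (by norm_num) N).le _ (by norm_num) hs
    (hr.trans_lt (Nat.lt_pow_succ_log_self (by norm_num) K))).trans_eq (by norm_num)

/-! ### Greedy search, with the longest chain of findable edges as potential -/

variable (D upd) in
/-- There is a sequence of `j` edges that can be found one after the other from the state `s`. -/
def Chain (G : SimpleGraph (Fin n)) : ℕ → σ → Prop
  | 0, _ => True
  | j + 1, s => ∃ x ∈ marked G (D s), Chain G j (upd s x)

/-- The search space loses each found pair for good, so the edges of a chain are distinct and all
lie in the initial space. -/
theorem Chain.le_card {G : SimpleGraph (Fin n)}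
    (hD : ∀ s, ∀ x ∈ D s, D (upd s x) ⊆ (D s).erase x) {j : ℕ} {s : σ}
    (h : Chain D upd G j s) : j ≤ (marked G (D s)).card := by
  induction j generalizing s with
  | zero => exact Nat.zero_le _
  | succ j ih =>
    obtain ⟨x, hx, h⟩ := h
    have hsub : marked G (D (upd s x)) ⊆ (marked G (D s)).erase x := by
      intro y hy
      obtain ⟨hy, hy'⟩ := Finset.mem_filter.1 hy
      obtain ⟨h₁, h₂⟩ := Finset.mem_erase.1 (hD s x (Finset.mem_filter.1 hx).1 hy)
      exact Finset.mem_erase.2 ⟨h₁, Finset.mem_filter.2 ⟨h₂, hy'⟩⟩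
    calc j + 1 ≤ ((marked G (D s)).erase x).card + 1 :=
          Nat.succ_le_succ ((ih h).trans (Finset.card_le_card hsub))
      _ = _ := Finset.card_erase_add_one hx

theorem Chain.le_of_rank {G : SimpleGraph (Fin n)} {ℓ : σ → ℕ} {K : ℕ}
    (hℓ : ∀ s, ∀ x ∈ D s, ℓ s < ℓ (upd s x)) (hK : ∀ s, ℓ s ≤ K) {j : ℕ} {s : σ}
    (h : Chain D upd G j s) : ℓ s + j ≤ K := by
  induction j generalizing s with
  | zero => exact hK s
  | succ j ih =>
    obtain ⟨x, hx, h⟩ := h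
    have := ih h
    have := hℓ s x (Finset.mem_filter.1 hx).1
    lia

open Classical in
/-- Greedy search: if the search space `D s` shrinks with each edge that is found, has at most `N`
elements, and at most `K` edges can be found, then with high probability the final state satisfies
each invariant, and no edge is left in its search space. -/
theorem expect_run_schedule_le {N K : ℕ} (hN : 0 < N)
    (hD : ∀ s, ∀ x ∈ D s, D (upd s x) ⊆ (D s).erase x) (hcard : ∀ s, (D s).card ≤ N)
    {ℓ : σ → ℕ} (hℓ : ∀ s, ∀ x ∈ D s, ℓ s < ℓ (upd s x)) (hK : ∀ s, ℓ s ≤ K)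
    (G : SimpleGraph (Fin n)) {I : σ → Prop}
    (hI : ∀ s, I s → ∀ x ∈ marked G (D s), I (upd s x)) {s : σ} (hs : I s) :
    (run x₀ D upd (schedule N K) s).expect G
      (fun s' => if I s' ∧ marked G (D s') = ∅ then 0 else 1) ≤ 1 / 6 := by
  -- The number of available edges could far exceed `K`, so the potential is the length of a longest
  -- chain. It is at most `K` by the rank `ℓ`, drops with each found edge, and vanishes only when no
  -- edge is left.
  set r : σ → ℕ := fun s => Nat.findGreatest (fun j => Chain D upd G j s) N
  have hr (s : σ) : Chain D upd G (r s) s :=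
    Nat.findGreatest_spec (P := fun j => Chain D upd G j s) (Nat.zero_le N) trivial
  have hmax {j : ℕ} {s : σ} (h : Chain D upd G j s) : j ≤ r s :=
    Nat.le_findGreatest ((h.le_card hD).trans
      ((Finset.card_le_card (Finset.filter_subset _ _)).trans (hcard s))) h
  have hpot : IsPotential D upd G N I r := {
    inv := hI
    lt := fun s _ x hx => hmax (j := r (upd s x) + 1) ⟨x, hx, hr _⟩
    le_card := fun s _ => (hr s).le_card hD
    card_le := hcard }
  refine (expect_run_mono hI (fun s hs => ?_) _ hs).trans
    (hpot.expect_run_schedule_le (x₀ := x₀) hN hs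
      (le_of_add_le_right ((hr s).le_of_rank hℓ hK)))
  by_cases h : marked G (D s) = ∅
  · rw [if_pos ⟨hs, h⟩]
    split <;> norm_num
  · obtain ⟨x, hx⟩ := Finset.nonempty_iff_ne_empty.2 h
    have : 1 ≤ r s := hmax (j := 1) ⟨x, hx, trivial⟩
    simp [h, this]

end Search

end QuantumQuery

/-! ### Matchings, stars and the kernel for vertex cover -/

namespace QuantumQuery

section VertexCover

variable {n : ℕ}

/-- The endpoints of the pairs in `s`. -/
def verts (s : Finset (Fin n × Fin n)) : Finset (Fin n) :=
  s.image Prod.fst ∪ s.image Prod.snd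

theorem verts_insert (s : Finset (Fin n × Fin n)) (x : Fin n × Fin n) :
    verts (insert x s) = insert x.1 (insert x.2 (verts s)) := by
  ext v
  simp only [verts, Finset.image_insert, Finset.mem_union, Finset.mem_insert]
  tauto

theorem card_verts_le (s : Finset (Fin n × Fin n)) : (verts s).card ≤ 2 * s.card := by
  have h₁ := Finset.card_union_le (s.image Prod.fst) (s.image Prod.snd)
  have h₂ := Finset.card_image_le (s := s) (f := Prod.fst)
  have h₃ := Finset.card_image_le (s := s) (f := Prod.snd)
  unfold verts
  lia

theorem adj_of_mem_marked {G : SimpleGraph (Fin n)} {D : Finset (Fin n × Fin n)}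
    {x : Fin n × Fin n} (h : x ∈ marked G D) : G.Adj x.1 x.2 := by
  simpa [adjBit] using (Finset.mem_filter.1 h).2

theorem mem_marked {G : SimpleGraph (Fin n)} {D : Finset (Fin n × Fin n)}
    {x : Fin n × Fin n} (hD : x ∈ D) (h : G.Adj x.1 x.2) : x ∈ marked G D :=
  Finset.mem_filter.2 ⟨hD, by simpa [adjBit] using h⟩

/-- The pairs that can extend the matching `M`, if it has at most `k` edges. -/
def matchingSpace (k : ℕ) (M : Finset (Fin n × Fin n)) : Finset (Fin n × Fin n) :=
  if M.card ≤ k then Finset.univ.filter fun x => x.1 ∉ verts M ∧ x.2 ∉ verts M else ∅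

theorem mem_matchingSpace {k : ℕ} {M : Finset (Fin n × Fin n)} {x : Fin n × Fin n} :
    x ∈ matchingSpace k M ↔ M.card ≤ k ∧ x.1 ∉ verts M ∧ x.2 ∉ verts M := by
  unfold matchingSpace
  split <;> simp [*]

/-- The pairs in `s` whose first component is `v`. -/
def starAt (s : Finset (Fin n × Fin n)) (v : Fin n) : Finset (Fin n × Fin n) :=
  s.filter fun x => x.1 = v

/-- The pairs not in `s` at an endpoint of `M` of which `s` has at most `k` pairs. -/
def starSpace (k : ℕ) (M s : Finset (Fin n × Fin n)) : Finset (Fin n × Fin n) :=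
  if M.card ≤ k then
    Finset.univ.filter fun x => x.1 ∈ verts M ∧ x ∉ s ∧ (starAt s x.1).card ≤ k
  else ∅

theorem mem_starSpace {k : ℕ} {M s : Finset (Fin n × Fin n)} {x : Fin n × Fin n} :
    x ∈ starSpace k M s ↔
      M.card ≤ k ∧ x.1 ∈ verts M ∧ x ∉ s ∧ (starAt s x.1).card ≤ k := by
  unfold starSpace
  split <;> simp [*]

theorem star_subset_insert (s : Finset (Fin n × Fin n)) (x : Fin n × Fin n) (v : Fin n) :
    starAt s v ⊆ starAt (insert x s) v :=
  Finset.filter_subset_filter _ (Finset.subset_insert _ _)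

/-- The number of pairs of `s` at endpoints of `M`, counting at most `k + 1` for each. -/
def starRank (k : ℕ) (M s : Finset (Fin n × Fin n)) : ℕ :=
  if M.card ≤ k then ∑ v ∈ verts M, min (starAt s v).card (k + 1) else 0

theorem matchingSpace_insert_subset (k : ℕ) (M : Finset (Fin n × Fin n)) :
    ∀ x ∈ matchingSpace k M, matchingSpace k (insert x M) ⊆ (matchingSpace k M).erase x := by
  intro x hx y hy
  rw [mem_matchingSpace] at hx hy
  rw [Finset.mem_erase, mem_matchingSpace]
  simp only [verts_insert, Finset.mem_insert, not_or] at hy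
  refine ⟨?_, hx.1, hy.2.1.2.2, hy.2.2.2.2⟩
  rintro rfl
  exact hy.2.1.1 rfl

/-- The greedy search wants a rank bounded on all states, reachable or not, hence the cap at `k +
1`. The cap does not spoil strictness, because the search space is empty once `M` has more than `k`
pairs. -/
theorem matchingRank_lt (k : ℕ) (M : Finset (Fin n × Fin n)) :
    ∀ x ∈ matchingSpace k M, min M.card (k + 1) < min (insert x M).card (k + 1) := by
  intro x hx
  rw [mem_matchingSpace] at hx
  have : x ∉ M := fun h => hx.2.1 (Finset.mem_union_left _ (Finset.mem_image_of_mem _ h))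
  rw [Finset.card_insert_of_notMem this]
  lia

theorem starSpace_insert_subset (k : ℕ) (M s : Finset (Fin n × Fin n)) :
    ∀ x ∈ starSpace k M s, starSpace k M (insert x s) ⊆ (starSpace k M s).erase x := by
  intro x _ y hy
  rw [mem_starSpace] at hy
  rw [Finset.mem_erase, mem_starSpace]
  simp only [Finset.mem_insert, not_or] at hy
  exact ⟨hy.2.2.1.1, hy.1, hy.2.1, hy.2.2.1.2,
    (Finset.card_le_card (star_subset_insert _ _ _)).trans hy.2.2.2⟩

theorem starRank_lt (k : ℕ) (M s : Finset (Fin n × Fin n)) :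
    ∀ x ∈ starSpace k M s, starRank k M s < starRank k M (insert x s) := by
  intro x hx
  rw [mem_starSpace] at hx
  rw [starRank, starRank, if_pos hx.1, if_pos hx.1]
  refine Finset.sum_lt_sum (fun v _ => ?_) ⟨x.1, hx.2.1, ?_⟩
  · exact min_le_min_right _ (Finset.card_le_card (star_subset_insert _ _ _))
  · have h : starAt (insert x s) x.1 = insert x (starAt s x.1) := by
      simp [starAt, Finset.filter_insert]
    have hmem : x ∉ starAt s x.1 := fun h => hx.2.2.1 (Finset.mem_filter.1 h).1
    rw [h, Finset.card_insert_of_notMem hmem]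
    have := hx.2.2.2
    lia

theorem starRank_le (k : ℕ) (M s : Finset (Fin n × Fin n)) :
    starRank k M s ≤ 2 * k * (k + 1) := by
  unfold starRank
  split
  · refine (Finset.sum_le_card_nsmul _ _ (k + 1) fun v _ => min_le_right _ _).trans ?_
    rw [smul_eq_mul]
    have := card_verts_le M
    exact Nat.mul_le_mul_right _ (by lia)
  · exact Nat.zero_le _

theorem card_matchingSpace_le (k : ℕ) (M : Finset (Fin n × Fin n)) :
    (matchingSpace k M).card ≤ n * n :=
  (Finset.card_le_univ _).trans_eq (by simp)

theorem card_starSpace_le (k : ℕ) (M s : Finset (Fin n × Fin n)) :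
    (starSpace k M s).card ≤ 2 * k * n := by
  by_cases h : M.card ≤ k
  · have hsub : starSpace k M s ⊆ verts M ×ˢ Finset.univ := fun x hx =>
      Finset.mem_product.2 ⟨(mem_starSpace.1 hx).2.1, Finset.mem_univ _⟩
    refine (Finset.card_le_card hsub).trans ?_
    rw [Finset.card_product, Finset.card_univ, Fintype.card_fin]
    have := card_verts_le M
    exact Nat.mul_le_mul_right _ (by lia)
  · simp [starSpace, h]

/-- The bound for vertex covers given by a matching `M`. -/
def IsCoverBound (G : SimpleGraph (Fin n)) (M : Finset (Fin n × Fin n)) : Prop :=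
  ∀ S : Finset (Fin n), G.IsVertexCover (S : Set (Fin n)) → M.card ≤ (S ∩ verts M).card

/-- A cover contains an endpoint of the new edge, and this endpoint is not among the old ones.
Counting only cover vertices in `verts M` is what makes the induction work. -/
theorem IsCoverBound.insert {G : SimpleGraph (Fin n)} {k : ℕ} {M : Finset (Fin n × Fin n)}
    (h : IsCoverBound G M) : ∀ x ∈ marked G (matchingSpace k M), IsCoverBound G (insert x M) := by
  intro x hx S hS
  have hD := mem_matchingSpace.1 (Finset.mem_filter.1 hx).1
  obtain ⟨v, hv, hvS, hvM⟩ : ∃ v, (v = x.1 ∨ v = x.2) ∧ v ∈ S ∧ v ∉ verts M := by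
    rcases hS (adj_of_mem_marked hx) with h | h
    · exact ⟨x.1, .inl rfl, h, hD.2.1⟩
    · exact ⟨x.2, .inr rfl, h, hD.2.2⟩
  have hsub : Insert.insert v (S ∩ verts M) ⊆ S ∩ verts (Insert.insert x M) := by
    rw [verts_insert]
    intro w hw
    simp only [Finset.mem_insert, Finset.mem_inter] at hw ⊢
    rcases hw with rfl | hw
    · exact ⟨hvS, by tauto⟩
    · exact ⟨hw.1, by tauto⟩
  calc _ ≤ M.card + 1 := Finset.card_insert_le _ _
    _ ≤ (S ∩ verts M).card + 1 := Nat.succ_le_succ (h S hS)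
    _ = (Insert.insert v (S ∩ verts M)).card :=
      (Finset.card_insert_of_notMem fun h => hvM (Finset.mem_inter.1 h).2).symm
    _ ≤ _ := Finset.card_le_card hsub

open Classical in
/-- A set of at most `k` vertices that covers `s`, if there is one and `M` has at most `k`
edges. -/
noncomputable def coverOutput (k : ℕ) (M s : Finset (Fin n × Fin n)) : Option (Finset (Fin n)) :=
  if h : M.card ≤ k ∧ ∃ S : Finset (Fin n), S.card ≤ k ∧ ∀ x ∈ s, x.1 ∈ S ∨ x.2 ∈ S then
    some h.2.choose
  else none

/-- Maximality of `M` leaves no edge away from `verts M`. An endpoint with at most `k` collected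
pairs has all its edges in `s`; one with more is forced into `S`. -/
theorem isVertexCover_of_covers {G : SimpleGraph (Fin n)} {k : ℕ}
    {M s : Finset (Fin n × Fin n)} (hk : M.card ≤ k) (hM : marked G (matchingSpace k M) = ∅)
    (hs : marked G (starSpace k M s) = ∅) {S : Finset (Fin n)} (hS : S.card ≤ k)
    (hSs : ∀ x ∈ s, x.1 ∈ S ∨ x.2 ∈ S) : G.IsVertexCover (S : Set (Fin n)) := by
  have key {v w : Fin n} (h : G.Adj v w) (hv : v ∈ verts M) : v ∈ S ∨ w ∈ S := by
    by_cases hvw : (v, w) ∈ s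
    · exact hSs _ hvw
    · left
      by_contra hvS
      have hbig : k < (starAt s v).card := by
        by_contra hc
        have := mem_marked (mem_starSpace.2 ⟨hk, hv, hvw, not_lt.1 hc⟩) h
        rw [hs] at this
        simp at this
      -- If `v ∉ S`, then `S` must contain the more than `k` distinct other ends of the pairs at
      -- `v`.
      refine hbig.not_ge ((Finset.card_le_card_of_injOn Prod.snd ?_ ?_).trans hS)
      · intro x hx
        obtain ⟨hxs, hxv⟩ := Finset.mem_filter.1 hx
        exact (hSs x hxs).resolve_left (hxv ▸ hvS)
      · intro x hx y hy hxy
        have hx' := (Finset.mem_filter.1 hx).2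
        have hy' := (Finset.mem_filter.1 hy).2
        exact Prod.ext (hx'.trans hy'.symm) hxy
  intro v w h
  by_cases hv : v ∈ verts M
  · exact key h hv
  · by_cases hw : w ∈ verts M
    · exact (key h.symm hw).symm
    · have := mem_marked (x := (v, w)) (mem_matchingSpace.2 ⟨hk, hv, hw⟩) h
      rw [hM] at this
      simp at this

theorem vertexCoverCorrect_coverOutput {G : SimpleGraph (Fin n)} {k : ℕ}
    {M s : Finset (Fin n × Fin n)} (hM : IsCoverBound G M)
    (hM' : marked G (matchingSpace k M) = ∅) (hs : ∀ x ∈ s, G.Adj x.1 x.2)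
    (hs' : marked G (starSpace k M s) = ∅) : VertexCoverCorrect k G (coverOutput k M s) := by
  unfold coverOutput
  split
  · rename_i h
    obtain ⟨h₁, h₂⟩ := h.2.choose_spec
    exact ⟨isVertexCover_of_covers h.1 hM' hs' h₁ h₂, h₁⟩
  · rename_i h
    rintro ⟨S, hS, hSk⟩
    refine h ⟨?_, S, hSk, fun x hx => hS (hs x hx)⟩
    exact (hM S hS).trans ((Finset.card_le_card Finset.inter_subset_left).trans hSk)

/-! ### The algorithm, its error and its query count -/

/-- Find a maximal matching, then edges at its endpoints, and then a vertex cover of these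
edges. -/
noncomputable def vertexCoverAlgorithm (x₀ : Fin n × Fin n) (k : ℕ) :
    Algorithm n (Option (Finset (Fin n))) :=
  (run x₀ (matchingSpace k) (fun M x => insert x M) (schedule (n * n) (k + 1)) ∅).bind
    (cost (schedule (2 * k * n) (2 * k * (k + 1)))) fun M =>
    (run x₀ (starSpace k M) (fun s x => insert x s)
      (schedule (2 * k * n) (2 * k * (k + 1))) ∅).map (coverOutput k M)

open Classical in
theorem solves_vertexCoverAlgorithm (x₀ : Fin n × Fin n) {k : ℕ} (hn : 1 ≤ n) (hk : 1 ≤ k) :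
    (vertexCoverAlgorithm x₀ k).SolvesWithBoundedError (VertexCoverCorrect k) := by
  intro G
  have h₁ := expect_run_schedule_le (x₀ := x₀) (D := matchingSpace (n := n) k)
    (upd := fun M x => insert x M) (N := n * n) (K := k + 1) (by positivity)
    (matchingSpace_insert_subset k) (card_matchingSpace_le k) (ℓ := fun M => min M.card (k + 1))
    (matchingRank_lt k) (fun M => min_le_right _ _) G (I := IsCoverBound G)
    (fun M hM x hx => hM.insert x hx) (s := ∅) (by simp [IsCoverBound])
  have h₂ (M : Finset (Fin n × Fin n)) := expect_run_schedule_le (x₀ := x₀)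
    (D := starSpace (n := n) k M)
    (upd := fun M x => insert x M) (N := 2 * k * n) (K := 2 * k * (k + 1)) (by positivity)
    (starSpace_insert_subset k M) (card_starSpace_le k M) (ℓ := starRank k M)
    (starRank_lt k M) (starRank_le k M) G (I := fun s => ∀ x ∈ s, G.Adj x.1 x.2)
    (fun s hs x hx => by
      simpa using ⟨adj_of_mem_marked hx, fun a b h => hs (a, b) h⟩) (s := ∅) (by simp)
  have h₃ : (vertexCoverAlgorithm x₀ k).expect G
      (fun a => if VertexCoverCorrect k G a then 0 else 1) ≤ 1 / 6 + 1 / 6 := by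
    rw [vertexCoverAlgorithm, Algorithm.expect_bind _ _ (fun M =>
      (run x₀ (starSpace k M) (fun s x => insert x s)
        (schedule (2 * k * n) (2 * k * (k + 1))) ∅).map (coverOutput k M)) _
        fun M => queries_run x₀ (starSpace k M) _ _ _]
    refine (Algorithm.expect_mono _ _ (g := fun M =>
      (if IsCoverBound G M ∧ marked G (matchingSpace k M) = ∅ then 0 else 1) + 1 / 6)
      fun M => ?_).trans ?_
    · rw [Algorithm.expect_map]
      split
      · rename_i hM
        rw [zero_add]
        refine (Algorithm.expect_mono _ _ fun s => ?_).trans (h₂ M)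
        split
        · split <;> norm_num
        · rename_i hc
          rw [if_neg]
          exact fun hs => hc (vertexCoverCorrect_coverOutput hM.1 hM.2 hs.1 hs.2)
      · refine (Algorithm.expect_mono _ _ (g := fun _ => 1) fun s => ?_).trans ?_
        · split <;> norm_num
        · rw [Algorithm.expect_const]
          norm_num
    · rw [Algorithm.expect_add, Algorithm.expect_const]
      linarith
  have h₄ : (vertexCoverAlgorithm x₀ k).expect G
      (fun a => if VertexCoverCorrect k G a then 1 else 0) +
      (vertexCoverAlgorithm x₀ k).expect G
      (fun a => if VertexCoverCorrect k G a then 0 else 1) = 1 := by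
    rw [← Algorithm.expect_add]
    refine Eq.trans ?_ (Algorithm.expect_const (vertexCoverAlgorithm x₀ k) G 1)
    congr 1
    ext a
    split <;> norm_num
  rw [Algorithm.prob_eq_expect]
  linarith

/-- Since `k < n`, neither phase looks for more edges than it has pairs, as `cost_schedule_le`
requires. The constant is `4 · 12288`, the factor `4` absorbing `k + 1 ≤ 2k` and the factors `2`. -/
theorem queries_vertexCoverAlgorithm_le (x₀ : Fin n × Fin n) {k : ℕ} (hk : 1 ≤ k) (hkn : k < n) :
    ((vertexCoverAlgorithm x₀ k).queries : ℝ) ≤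
      49152 * (√k * n + (k : ℝ) ^ (3 / 2 : ℝ) * √n) := by
  have hq : (vertexCoverAlgorithm x₀ k).queries = cost (schedule (n * n) (k + 1)) +
      cost (schedule (2 * k * n) (2 * k * (k + 1))) :=
    congrArg (· + _) (queries_run x₀ (matchingSpace k) _ _ _)
  have h₁ := cost_schedule_le (N := n * n) (K := k + 1) (by lia) (by nlinarith)
  have h₂ := cost_schedule_le (N := 2 * k * n) (K := 2 * k * (k + 1)) (by positivity)
    (Nat.mul_le_mul_left _ hkn)
  have hk' : (1 : ℝ) ≤ k := by exact_mod_cast hk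
  have hn' : (0 : ℝ) ≤ n := Nat.cast_nonneg n
  have h₃ : √((n * n : ℕ) * (k + 1 : ℕ) : ℝ) ≤ 4 * (√k * n) := by
    rw [Real.sqrt_le_iff]
    refine ⟨by positivity, ?_⟩
    rw [mul_pow, mul_pow, Real.sq_sqrt (by positivity)]
    push_cast
    nlinarith [mul_nonneg hn' hn']
  have h₄ : √((2 * k * n : ℕ) * (2 * k * (k + 1) : ℕ) : ℝ) ≤
      4 * ((k : ℝ) ^ (3 / 2 : ℝ) * √n) := by
    rw [Real.sqrt_le_iff]
    refine ⟨by positivity, ?_⟩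
    rw [mul_pow, mul_pow, Real.sq_sqrt (by positivity), ← Real.rpow_mul_natCast (by positivity)]
    have : ((3 / 2 : ℝ) * (2 : ℕ)) = (3 : ℕ) := by norm_num
    rw [this, Real.rpow_natCast]
    push_cast
    have h : 0 ≤ (k : ℝ) ^ 2 * n := by positivity
    nlinarith
  rw [hq]
  push_cast
  linarith

end VertexCover

end QuantumQuery

theorem theorem1 :
    ∃ C : ℝ, ∀ n k : ℕ, 1 ≤ n → 1 ≤ k →
      ∃ A : QuantumQuery.Algorithm n (Option (Finset (Fin n))),
        A.SolvesWithBoundedError (QuantumQuery.VertexCoverCorrect k) ∧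
        (A.queries : ℝ) ≤
          C * (Real.sqrt (k : ℝ) * (n : ℝ) + (k : ℝ) ^ (3 / 2 : ℝ) * Real.sqrt (n : ℝ)) := by
  refine ⟨49152, fun n k hn hk => ?_⟩
  have x₀ : Fin n × Fin n := (⟨0, hn⟩, ⟨0, hn⟩)
  -- If `k ≥ n`, the set of all vertices is a valid answer and no query is needed.
  rcases lt_or_ge k n with hkn | hkn
  · exact ⟨QuantumQuery.vertexCoverAlgorithm x₀ k,
      QuantumQuery.solves_vertexCoverAlgorithm x₀ hn hk,
      QuantumQuery.queries_vertexCoverAlgorithm_le x₀ hk hkn⟩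
  · refine ⟨QuantumQuery.Algorithm.query 0 x₀ fun _ => some Finset.univ, fun G => ?_, ?_⟩
    · have : QuantumQuery.VertexCoverCorrect k G (some Finset.univ) :=
        ⟨fun v w _ => by simp, by simpa using hkn⟩
      rw [QuantumQuery.Algorithm.prob_eq_expect, QuantumQuery.Algorithm.expect_constOut,
        if_pos this]
      norm_num
    · have : (QuantumQuery.Algorithm.query 0 x₀ fun _ => some (Finset.univ : Finset (Fin n))).queries
        = 0 := rfl
      rw [this, Nat.cast_zero]
      positivity
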